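/- Let $\lambda$ be a partition of an integer $n\ge 0$. For a standard Young tableau (SYT) $T$ of shape $\lambda$ (written with row indices increasing downwards) let $D(T)$ be the set of all $i$ such that $i+1$ is in a lower row of $T$ than $i$. Call $T$ \emph{alternating} if $D(T)=\{1,3,5,\dots\}\cap\{1,\dots,n-1\}$ and \emph{reverse alternating} if $D(T)=\{2,4,6,\dots\}\cap\{1,\dots,n-1\}$, and let $\mathrm{alt}(\lambda)$, respectively $\mathrm{ralt}(\lambda)$, be the number of alternating, respectively reverse alternating, SYT of shape $\lambda$. Let $E_k$ be the Euler number, that is, the number of permutations $a_1a_2\cdots a_k$ of $\{1,\dots,k\}$ with $a_1>a_2<a_3>a_4<\cdots$ (so $E_0=1$). Let $s_\lambda$ be the Schur function in the variables $x_1,x_2,\dots$, i.e. the sum of the monomials $x^T$ over all semistandard Young tableaux $T$ of shape $\lambda$, and let $p_k=\sum_i x_i^k$ for $k\ge1$ be the power sums. There is a unique polynomial $P$ with rational coefficients such that $s_\lambda=P(p_1,p_2,p_3,\dots)$. Write $s_\lambda[a_1,a_2,a_3,\dots]=P(a_1,a_2,a_3,\dots)$. If the $a_i$ are polynomials in an indeterminate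 $E$, this expression is evaluated \emph{umbrally}: it is expanded in powers of $E$, and as the last step each $E^k$ is replaced by the Euler number $E_k$. With these conventions: If $n$ is odd, then $$\mathrm{alt}(\lambda)=\mathrm{ralt}(\lambda)=s_\lambda[E,0,-E,0,E,0,-E,0,\dots].$$ If $n$ is even, then $$\mathrm{alt}(\lambda)=s_\lambda[E,-1,-E,1,E,-1,-E,1,\dots],$$ $$\mathrm{ralt}(\lambda)=s_\lambda[E,1,-E,-1,E,1,-E,-1,\dots].$$ All sequences substituted here have period $4$. -/

import Mathlib

namespace AltTableaux

/-! ### Permutations and Euler numbers -/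

/-- The set `{1, 3, 5, …} ∩ {1, …, n - 1}`. -/
def oddPositions (n : ℕ) : Set ℕ := {i | 1 ≤ i ∧ i < n ∧ Odd i}

/-- The set `{2, 4, 6, …} ∩ {1, …, n - 1}`. -/
def evenPositions (n : ℕ) : Set ℕ := {i | 1 ≤ i ∧ i < n ∧ Even i}

/-- The descent set of a permutation `w = a₁ a₂ ⋯ aₙ`: all `i` in `{1, …, n - 1}` with
`aᵢ > aᵢ₊₁`. Since `Fin n` is numbered from `0`, the letter `aᵢ` is `w ⟨i - 1, _⟩`; below `i = j + 1`. -/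
def permDescentSet {n : ℕ} (w : Equiv.Perm (Fin n)) : Set ℕ :=
  {i | ∃ (j : ℕ) (h : j + 1 < n),
    i = j + 1 ∧ w ⟨j + 1, h⟩ < w ⟨j, Nat.lt_of_succ_lt h⟩}

/-- The Euler number `Eₙ`: the number of alternating permutations `a₁ > a₂ < a₃ > ⋯` of `n` letters,
that is, of those with descent set `{1, 3, 5, …} ∩ {1, …, n - 1}`. -/
noncomputable def eulerNumber (n : ℕ) : ℕ :=
  Nat.card {w : Equiv.Perm (Fin n) // permDescentSet w = oddPositions n}

/-- Umbral evaluation of a polynomial in `E`: every power `E ^ k` is replaced by the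
Euler number `E_k`. -/
noncomputable def umbralEval (q : Polynomial ℚ) : ℚ :=
  q.sum fun k a => a * (eulerNumber k : ℚ)

/-! ### Standard Young tableaux -/

/-- A semistandard Young tableau is standard if each of `1, …, n` occurs exactly once,
where `n` is the number of cells. -/
def IsStandard {μ : YoungDiagram} (T : SemistandardYoungTableau μ) : Prop :=
  Set.BijOn (fun c : ℕ × ℕ => T c.1 c.2) (μ.cells : Set (ℕ × ℕ)) (Set.Icc 1 μ.card)

/-- The descent set of a tableau: all `i` such that `i + 1` is in a lower row than `i`
(row indices grow downwards). -/
def descentSet {μ : YoungDiagram} (T : SemistandardYoungTableau μ) : Set ℕ :=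
  {i | ∃ c ∈ μ, ∃ c' ∈ μ, T c.1 c.2 = i ∧ T c'.1 c'.2 = i + 1 ∧ c.1 < c'.1}

/-- The number of alternating standard Young tableaux of shape `μ`. -/
noncomputable def alt (μ : YoungDiagram) : ℕ :=
  Nat.card {T : SemistandardYoungTableau μ // IsStandard T ∧ descentSet T = oddPositions μ.card}

/-- The number of reverse alternating standard Young tableaux of shape `μ`. -/
noncomputable def ralt (μ : YoungDiagram) : ℕ :=
  Nat.card {T : SemistandardYoungTableau μ // IsStandard T ∧ descentSet T = evenPositions μ.card}

/-! ### Symmetric functions, as formal power series in `x₀, x₁, x₂, …` -/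

/-- The power sum `p_k = ∑ᵢ xᵢ ^ k` (used for `k ≥ 1` only). -/
noncomputable def powerSum (k : ℕ) : MvPowerSeries ℕ ℚ :=
  open Classical in fun d => if ∃ i : ℕ, d = Finsupp.single i k then 1 else 0

/-- The Schur function `s_μ = ∑_T x ^ T`, over all semistandard Young tableaux `T` of shape `μ`:
the coefficient of `x ^ d` is the number of those `T` with exactly `d i` entries equal to `i`,
for every `i`. -/
noncomputable def schur (μ : YoungDiagram) : MvPowerSeries ℕ ℚ := fun d =>
  (Nat.card {T : SemistandardYoungTableau μ //
    ∀ i : ℕ, (μ.cells.filter fun c => T c.1 c.2 = i).card = d i} : ℚ)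

/-- `P` expresses `f` as a polynomial in the power sums: `f = P(p₁, p₂, p₃, …)`.
The variable of `P` with index `k` stands for `p_{k+1}`. -/
def IsPowerSumExpansion (P : MvPolynomial ℕ ℚ) (f : MvPowerSeries ℕ ℚ) : Prop :=
  MvPolynomial.aeval (fun k : ℕ => powerSum (k + 1)) P = f

/-- The sequence `a, b, c, d, a, b, c, d, …` of period four. -/
def periodic {R : Type*} (a b c d : R) (k : ℕ) : R :=
  if k % 4 = 0 then a else if k % 4 = 1 then b else if k % 4 = 2 then c else d

/-- The umbral value of `P[a, b, c, d, a, b, c, d, …]`, where `a, b, c, d` are polynomials in `E`: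
`a, b, c, d, a, …` are substituted for `p₁, p₂, p₃, p₄, p₅, …`, the result is expanded in powers
of `E`, and finally each `E ^ k` is replaced by the Euler number `E_k`. -/
noncomputable def umbralSubst (P : MvPolynomial ℕ ℚ) (a b c d : Polynomial ℚ) : ℚ :=
  umbralEval (MvPolynomial.aeval (periodic a b c d) P)

/-- The umbral variable `E`. -/
noncomputable abbrev E : Polynomial ℚ := Polynomial.X

end AltTableaux

/-! Both counts are values of a linear functional on power series, so it suffices to compute that
functional on products of power sums.

Standardization shows that the standard tableaux with descent set contained in `B` are counted by
the coefficient of the Schur function at the content whose block sizes are cut out by `B`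
(`card_standard_descentSet_subset`). Inclusion–exclusion over `B ⊆ S` gives the count for descent
set exactly `S` as `ribbonPairing n S` applied to the Schur function (`ribbonPairing_schur`). The
same functional at `p₁ ^ n` counts permutations with descent set `S`, which is where Euler numbers
enter (`ribbonPairing_powerSum_one_pow`).

For a product of power sums with parts `w i` and `S` the odd or the even positions, splitting off
the first block of `B` gives a recursion over subsets of the parts that only sees their parities
(`evenSum_eq`, `oddSum_eq`). Odd parts may therefore be replaced by `1`, and an even part
contributes a sign or kills the value (`evenSum_insert`, `oddSum_insert`). The result is a sign,
times a power of `0` or `±1` with one factor per even part, times the Euler number of the number of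
odd parts (`ribbonPairing_oddFinset`, `ribbonPairing_evenFinset`). This is what the period-four
substitution yields on the same monomial (`umbralLinear_prod_periodic`).

Existence and uniqueness of the expansion rest on the symmetry of Schur functions, by Bender–Knuth
involutions (`swapInvariant_schur`), and on the power sums being algebraically independent
generators over `ℚ` (`powerSumEval_injective`, `exists_powerSumEval_eq`). -/

namespace AltTableaux

/-! ### Power sums freely generate the symmetric functions over `ℚ`. -/

open MvPolynomial in
theorem esymm_mem_adjoin_psum (N k : ℕ) :
    k ≤ N → esymm (Fin N) ℚ k ∈
      Algebra.adjoin ℚ (Set.range fun i : Fin N => psum (Fin N) ℚ (i + 1)) := by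
  induction k using Nat.strong_induction_on with
  | _ k ih =>
    intro hk
    rcases Nat.eq_zero_or_pos k with rfl | hpos
    · simp
    have h := mul_esymm_eq_sum (Fin N) ℚ k
    have hk0 : (k : ℚ) ≠ 0 := by positivity
    -- Newton's identity determines `k • e_k`; dividing by `k` is where characteristic zero is used.
    have h2 : esymm (Fin N) ℚ k = (k : ℚ)⁻¹ • ((k : MvPolynomial (Fin N) ℚ) * esymm (Fin N) ℚ k) := by
      rw [← nsmul_eq_mul, ← Nat.cast_smul_eq_nsmul ℚ, smul_smul, inv_mul_cancel₀ hk0, one_smul]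
    rw [h2, h]
    refine Subalgebra.smul_mem _ (Subalgebra.mul_mem _ ?_ (Subalgebra.sum_mem _ ?_)) _
    · exact Subalgebra.pow_mem _ (Subalgebra.neg_mem _ (Subalgebra.one_mem _)) _
    · intro a ha
      rw [Finset.mem_filter, Finset.HasAntidiagonal.mem_antidiagonal] at ha
      refine Subalgebra.mul_mem _ (Subalgebra.mul_mem _ ?_ (ih _ ha.2 (by omega))) ?_
      · exact Subalgebra.pow_mem _ (Subalgebra.neg_mem _ (Subalgebra.one_mem _)) _
      · refine Algebra.subset_adjoin ⟨⟨a.2 - 1, by omega⟩, ?_⟩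
        show psum _ _ (a.2 - 1 + 1) = _
        congr 1
        omega

/-- The algebra homomorphism sending the `i`-th variable to the `(i+1)`-st power sum. -/
noncomputable def psumAlgHom (N : ℕ) :
    MvPolynomial (Fin N) ℚ →ₐ[ℚ] MvPolynomial.symmetricSubalgebra (Fin N) ℚ :=
  MvPolynomial.aeval fun i =>
    ⟨MvPolynomial.psum (Fin N) ℚ (i + 1), MvPolynomial.psum_isSymmetric _ _ _⟩

theorem psumAlgHom_apply (N : ℕ) (p : MvPolynomial (Fin N) ℚ) :
    (psumAlgHom N p).val =
      MvPolynomial.aeval (fun i : Fin N => MvPolynomial.psum (Fin N) ℚ (i + 1)) p :=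
  (Subalgebra.mvPolynomial_aeval_coe _ _ _).symm

theorem psumAlgHom_surjective (N : ℕ) : Function.Surjective (psumAlgHom N) := by
  intro s
  obtain ⟨q, hq⟩ := MvPolynomial.esymmAlgHom_fin_surjective (R := ℚ) (le_refl N) s
  have hs : s.val ∈ Algebra.adjoin ℚ
      (Set.range fun i : Fin N => MvPolynomial.psum (Fin N) ℚ (i + 1)) := by
    rw [← hq, MvPolynomial.esymmAlgHom_apply]
    have h : ∀ i : Fin N, MvPolynomial.esymm (Fin N) ℚ (i + 1) ∈ Algebra.adjoin ℚ
      (Set.range fun i : Fin N => MvPolynomial.psum (Fin N) ℚ (i + 1)) :=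
      fun i => esymm_mem_adjoin_psum N _ i.2
    have := (MvPolynomial.aeval (fun i : Fin N =>
      (⟨_, h i⟩ : Algebra.adjoin ℚ
      (Set.range fun i : Fin N => MvPolynomial.psum (Fin N) ℚ (i + 1)))) q).2
    rwa [← Subalgebra.mvPolynomial_aeval_coe] at this
  rw [Algebra.adjoin_range_eq_range_aeval] at hs
  obtain ⟨p, hp⟩ := hs
  exact ⟨p, Subtype.ext ((psumAlgHom_apply N p).trans hp)⟩

/-- The kernels of the powers of `φ` stabilize, say at `n`. An element of `ker φ` is `φ ^ n` of some
`y`; then `y ∈ ker (φ ^ (n + 1)) = ker (φ ^ n)`, so the element is zero. -/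
theorem ringHom_injective_of_surjective {R : Type*} [CommRing R] [IsNoetherianRing R]
    (φ : R →+* R) (hφ : Function.Surjective φ) : Function.Injective φ := by
  let K : ℕ →o Ideal R :=
    { toFun := fun n => RingHom.ker (φ ^ n)
      monotone' := by
        refine monotone_nat_of_le_succ fun n x hx => ?_
        rw [RingHom.mem_ker] at hx ⊢
        rw [pow_succ', RingHom.mul_def, RingHom.comp_apply, hx, map_zero] }
  obtain ⟨n, hn⟩ := monotone_stabilizes_iff_noetherian.2 ‹IsNoetherianRing R› K
  have hsurj : Function.Surjective (φ ^ n) := by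
    rw [RingHom.coe_pow]
    exact hφ.iterate n
  rw [injective_iff_map_eq_zero]
  intro x hx
  obtain ⟨y, rfl⟩ := hsurj x
  have hy : y ∈ K (n + 1) := by
    show y ∈ RingHom.ker (φ ^ (n + 1))
    rw [RingHom.mem_ker, pow_succ', RingHom.mul_def, RingHom.comp_apply, hx]
  rw [← hn (n + 1) (Nat.le_succ n)] at hy
  exact hy

/-- Identifying symmetric polynomials with the polynomial ring through the elementary ones turns
`psumAlgHom` into a surjective endomorphism of a noetherian ring. This gives algebraic independence
without any determinant. -/
theorem psumAlgHom_injective (N : ℕ) : Function.Injective (psumAlgHom N) := by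
  let e := (AlgEquiv.ofBijective _ (MvPolynomial.esymmAlgHom_fin_bijective ℚ N)).symm
  let φ : MvPolynomial (Fin N) ℚ →+* MvPolynomial (Fin N) ℚ :=
    (e : _ →ₐ[ℚ] _).toRingHom.comp (psumAlgHom N).toRingHom
  have hsurj : Function.Surjective φ := e.surjective.comp (psumAlgHom_surjective N)
  have hinj : Function.Injective φ := ringHom_injective_of_surjective φ hsurj
  exact Function.Injective.of_comp (f := e) hinj

theorem coeff_powerSum (k : ℕ) (d : ℕ →₀ ℕ) :
    MvPowerSeries.coeff d (powerSum k) =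
      open Classical in if ∃ i : ℕ, d = Finsupp.single i k then 1 else 0 := rfl

theorem killCompl_powerSum (N k : ℕ) (hk : k ≠ 0) :
    MvPowerSeries.killCompl Fin.valEmbedding (powerSum k) =
      ((MvPolynomial.psum (Fin N) ℚ k : MvPolynomial (Fin N) ℚ) : MvPowerSeries (Fin N) ℚ) := by
  classical
  ext d
  rw [MvPowerSeries.coeff_killCompl, coeff_powerSum, MvPolynomial.coeff_coe, MvPolynomial.psum,
    MvPolynomial.coeff_sum]
  simp_rw [MvPolynomial.coeff_X_pow]
  by_cases h : ∃ i : Fin N, d = Finsupp.single i k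
  · obtain ⟨i, rfl⟩ := h
    rw [if_pos ⟨i, by simp [Finsupp.embDomain_single]⟩, Finset.sum_eq_single i]
    · simp
    · intro j _ hj
      rw [if_neg]
      intro h
      exact hj ((Finsupp.single_left_inj hk).1 h)
    · simp
  · rw [if_neg, Finset.sum_eq_zero]
    · intro i _
      rw [if_neg]
      exact fun h' => h ⟨i, h'.symm⟩
    · rintro ⟨i, hi⟩
      have hmem : i ∈ (Finsupp.embDomain Fin.valEmbedding d).support := by
        rw [hi, Finsupp.mem_support_iff, Finsupp.single_eq_same]; exact hk
      rw [Finsupp.support_embDomain, Finset.mem_map] at hmem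
      obtain ⟨j, _, rfl⟩ := hmem
      refine h ⟨j, ?_⟩
      apply Finsupp.embDomain_injective Fin.valEmbedding
      rw [hi, Finsupp.embDomain_single]

/-- Evaluation at the power sums in infinitely many variables. -/
noncomputable def powerSumEval : MvPolynomial ℕ ℚ →ₐ[ℚ] MvPowerSeries ℕ ℚ :=
  MvPolynomial.aeval fun k : ℕ => powerSum (k + 1)

theorem killCompl_powerSumEval_rename (N : ℕ) (q : MvPolynomial (Fin N) ℚ) :
    MvPowerSeries.killCompl Fin.valEmbedding (powerSumEval (MvPolynomial.rename Fin.val q)) =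
      ((psumAlgHom N q).val : MvPowerSeries (Fin N) ℚ) := by
  have : ((MvPowerSeries.killCompl (R := ℚ) (Fin.valEmbedding (n := N))).comp powerSumEval).comp
      (MvPolynomial.rename Fin.val) =
      (MvPolynomial.coeToMvPowerSeries.algHom ℚ (σ := Fin N) (R := ℚ)).comp
        ((MvPolynomial.symmetricSubalgebra (Fin N) ℚ).val.comp (psumAlgHom N)) := by
    ext1 i
    simp [powerSumEval, psumAlgHom, killCompl_powerSum, MvPolynomial.coeToMvPowerSeries.algHom_apply]
  have h := AlgHom.congr_fun this q
  simpa [MvPolynomial.coeToMvPowerSeries.algHom_apply] using h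

/-- A polynomial involves finitely many power sums, say among the first `N`. Setting all but `N`
variables to zero keeps these independent. -/
theorem powerSumEval_injective : Function.Injective powerSumEval := by
  rw [injective_iff_map_eq_zero]
  intro P hP
  obtain ⟨N, hN⟩ : ∃ N, P.vars ⊆ Finset.range N := P.vars.exists_nat_subset_range
  obtain ⟨q, rfl⟩ := MvPolynomial.exists_rename_eq_of_vars_subset_range P (Fin.val : Fin N → ℕ)
    Fin.val_injective (by
      intro x hx
      exact ⟨⟨x, Finset.mem_range.1 (hN hx)⟩, rfl⟩)
  have h := killCompl_powerSumEval_rename N q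
  rw [hP, map_zero] at h
  have h2 : psumAlgHom N q = 0 := by
    apply Subtype.ext
    apply MvPolynomial.coe_injective
    rw [← h]
    simp
  rw [(injective_iff_map_eq_zero _).1 (psumAlgHom_injective N) q h2, map_zero]

/-! ### Homogeneous symmetric series are polynomials in the power sums. -/

/-- The weight of the variable `p_{k+1}`. -/
def psWeight (k : ℕ) : ℕ := k + 1

/-- All monomials of the power series have degree `n`. -/
def HomogeneousSeries (f : MvPowerSeries ℕ ℚ) (n : ℕ) : Prop :=
  ∀ d : ℕ →₀ ℕ, d.degree ≠ n → MvPowerSeries.coeff d f = 0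

theorem homogeneousSeries_powerSum (k : ℕ) : HomogeneousSeries (powerSum k) k := by
  intro d hd
  rw [coeff_powerSum, if_neg]
  rintro ⟨i, rfl⟩
  exact hd (Finsupp.degree_single i k)

theorem HomogeneousSeries.mul {f g : MvPowerSeries ℕ ℚ} {p q : ℕ} (hf : HomogeneousSeries f p)
    (hg : HomogeneousSeries g q) : HomogeneousSeries (f * g) (p + q) := by
  classical
  intro d hd
  rw [MvPowerSeries.coeff_mul]
  refine Finset.sum_eq_zero fun x hx => ?_
  rw [Finset.HasAntidiagonal.mem_antidiagonal] at hx
  by_cases h1 : x.1.degree = p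
  · rw [hg x.2, mul_zero]
    intro h2
    exact hd (by rw [← hx, map_add, h1, h2])
  · rw [hf _ h1, zero_mul]

theorem homogeneousSeries_prod {ι : Type*} (s : Finset ι) (f : ι → MvPowerSeries ℕ ℚ) (w : ι → ℕ)
    (h : ∀ i ∈ s, HomogeneousSeries (f i) (w i)) :
    HomogeneousSeries (∏ i ∈ s, f i) (∑ i ∈ s, w i) := by
  classical
  induction s using Finset.induction_on with
  | empty =>
    intro d hd
    rw [Finset.prod_empty, MvPowerSeries.coeff_one, if_neg]
    rintro rfl
    simp at hd
  | insert a s ha ih =>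
    rw [Finset.prod_insert ha, Finset.sum_insert ha]
    exact (h a (by simp)).mul (ih fun i hi => h i (by simp [hi]))

theorem powerSumEval_monomial (m : ℕ →₀ ℕ) (c : ℚ) :
    powerSumEval (MvPolynomial.monomial m c) =
      c • ∏ k ∈ m.support, powerSum (k + 1) ^ m k := by
  rw [powerSumEval, MvPolynomial.aeval_monomial, Finsupp.prod, Algebra.smul_def]

theorem homogeneousSeries_monomial (m : ℕ →₀ ℕ) :
    HomogeneousSeries (∏ k ∈ m.support, powerSum (k + 1) ^ m k) (Finsupp.weight psWeight m) := by
  have := homogeneousSeries_prod m.support (fun k => powerSum (k + 1) ^ m k)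
    (fun k => m k * (k + 1)) fun k _ => by
      simpa using homogeneousSeries_prod (Finset.range (m k)) (fun _ => powerSum (k + 1))
        (fun _ => k + 1) fun _ _ => homogeneousSeries_powerSum _
  rw [Finsupp.weight_apply, Finsupp.sum]
  simpa [psWeight] using this

theorem coeff_powerSumEval_weightedHomogeneousComponent (n : ℕ) (d : ℕ →₀ ℕ) (hd : d.degree = n)
    (P : MvPolynomial ℕ ℚ) :
    MvPowerSeries.coeff d (powerSumEval (MvPolynomial.weightedHomogeneousComponent psWeight n P)) =
      MvPowerSeries.coeff d (powerSumEval P) := by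
  classical
  conv_rhs => rw [P.as_sum]
  rw [MvPolynomial.weightedHomogeneousComponent_apply, map_sum, map_sum, map_sum, map_sum,
    Finset.sum_filter]
  refine Finset.sum_congr rfl fun m _ => ?_
  split_ifs with h
  · rfl
  · rw [powerSumEval_monomial, map_smul, homogeneousSeries_monomial, smul_zero]
    rw [hd]
    exact Ne.symm h

theorem homogeneousSeries_powerSumEval (n : ℕ) (P : MvPolynomial ℕ ℚ)
    (hP : P.IsWeightedHomogeneous psWeight n) : HomogeneousSeries (powerSumEval P) n := by
  intro d hd
  rw [P.as_sum, map_sum, map_sum]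
  refine Finset.sum_eq_zero fun m hm => ?_
  rw [powerSumEval_monomial, map_smul, homogeneousSeries_monomial, smul_zero]
  rw [hP (MvPolynomial.mem_support_iff.1 hm)]
  exact hd

/-- Invariance of a power series under transpositions of the variables. -/
def SwapInvariant (f : MvPowerSeries ℕ ℚ) : Prop :=
  ∀ (a b : ℕ) (d : ℕ →₀ ℕ),
    MvPowerSeries.coeff (Finsupp.embDomain (Equiv.swap a b).toEmbedding d) f =
      MvPowerSeries.coeff d f

/-- Permuting the variables is an algebra endomorphism that fixes every power sum. -/
theorem swapInvariant_powerSumEval (P : MvPolynomial ℕ ℚ) : SwapInvariant (powerSumEval P) := by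
  intro a b d
  have : (MvPowerSeries.killCompl (R := ℚ) (Equiv.swap a b).toEmbedding).comp powerSumEval =
      powerSumEval := by
    ext k d
    simp only [powerSumEval, AlgHom.comp_apply, MvPolynomial.aeval_X, MvPowerSeries.coeff_killCompl,
      coeff_powerSum]
    congr 1
    rw [eq_iff_iff]
    constructor
    · rintro ⟨i, hi⟩
      refine ⟨Equiv.swap a b i, Finsupp.embDomain_injective (Equiv.swap a b).toEmbedding ?_⟩
      rw [hi, Finsupp.embDomain_single]
      simp
    · rintro ⟨i, rfl⟩
      exact ⟨Equiv.swap a b i, by rw [Finsupp.embDomain_single]; rfl⟩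
  rw [← MvPowerSeries.coeff_killCompl]
  exact congrArg _ (AlgHom.congr_fun this P)

theorem exists_symmetric_truncation (n N : ℕ) (f : MvPowerSeries ℕ ℚ) (hf : HomogeneousSeries f n)
    (hs : SwapInvariant f) : ∃ g : MvPolynomial.symmetricSubalgebra (Fin N) ℚ,
      MvPowerSeries.killCompl Fin.valEmbedding f = (g.val : MvPowerSeries (Fin N) ℚ) := by
  classical
  -- Every exponent in a monomial of degree `n` is at most `n`, so truncating at this bound loses
  -- nothing.
  let D : Fin N →₀ ℕ := Finsupp.equivFunOnFinite.symm fun _ => n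
  let g := MvPowerSeries.trunc' ℚ D (MvPowerSeries.killCompl Fin.valEmbedding f)
  have hg : ∀ d, MvPolynomial.coeff d g =
      MvPowerSeries.coeff (Finsupp.embDomain Fin.valEmbedding d) f := by
    intro d
    rw [MvPowerSeries.coeff_trunc', MvPowerSeries.coeff_killCompl]
    split_ifs with h
    · rfl
    · symm
      apply hf
      intro h'
      apply h
      intro i
      show d i ≤ n
      rw [← h', Finsupp.embDomain_eq_mapDomain, Finsupp.degree_mapDomain]
      exact Finsupp.le_degree i d
  refine ⟨⟨g, ?_⟩, ?_⟩
  · rw [MvPolynomial.mem_symmetricSubalgebra]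
    intro e
    induction e using Equiv.Perm.swap_induction_on with
    | one => exact MvPolynomial.rename_id_apply g
    | swap_mul e x y hxy ih =>
      have hswap : MvPolynomial.rename (Equiv.swap x y) g = g := by
        ext d
        have hd : d = Finsupp.mapDomain (Equiv.swap x y) (Finsupp.mapDomain (Equiv.swap x y) d) := by
          rw [← Finsupp.mapDomain_comp]
          have : (Equiv.swap x y : Fin N → Fin N) ∘ Equiv.swap x y = id := by
            ext; simp
          rw [this, Finsupp.mapDomain_id]
        conv_lhs => rw [hd]
        rw [MvPolynomial.coeff_rename_mapDomain _ (Equiv.injective _), hg, hg,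
          ← hs x y (Finsupp.embDomain _ d)]
        congr 1
        simp only [Finsupp.embDomain_eq_mapDomain]
        rw [← Finsupp.mapDomain_comp, ← Finsupp.mapDomain_comp]
        refine congrArg (fun e => MvPowerSeries.coeff (Finsupp.mapDomain e d)) (funext fun z => ?_)
        simp only [Function.comp, Fin.valEmbedding_apply, Equiv.coe_toEmbedding]
        rw [Equiv.swap_apply_def, Equiv.swap_apply_def]
        simp only [Fin.ext_iff]
        split_ifs <;> rfl
      rw [Equiv.Perm.coe_mul, ← MvPolynomial.rename_rename, ih, hswap]
  · ext d
    rw [MvPolynomial.coeff_coe, hg, MvPowerSeries.coeff_killCompl]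

/-- A monomial in at most `n` variables can be moved into the first `n` by transpositions. Each swap
of a used index `a ≥ n` with an unused `b < n` lowers by one the number `k` of used indices outside
the range. -/
theorem coeff_eq_zero_of_truncation (n : ℕ) (f : MvPowerSeries ℕ ℚ) (hs : SwapInvariant f)
    (h : MvPowerSeries.killCompl (Fin.valEmbedding (n := n)) f = 0) (k : ℕ) :
    ∀ d : ℕ →₀ ℕ, d.support.card ≤ n → (d.support \ Finset.range n).card = k →
      MvPowerSeries.coeff d f = 0 := by
  induction k with
  | zero =>
    intro d _ hd
    rw [Finset.card_eq_zero, Finset.sdiff_eq_empty_iff_subset] at hd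
    obtain ⟨d', rfl⟩ : d ∈ Set.range (Finsupp.embDomain (M := ℕ) (Fin.valEmbedding (n := n))) := by
      rw [Finsupp.mem_range_embDomain_iff]
      intro x hx
      exact ⟨⟨x, Finset.mem_range.1 (hd hx)⟩, rfl⟩
    rw [← MvPowerSeries.coeff_killCompl, h, map_zero]
  | succ k ih =>
    intro d hd hk
    obtain ⟨a, ha⟩ : (d.support \ Finset.range n).Nonempty := by
      rw [← Finset.card_pos]; omega
    obtain ⟨b, hb⟩ : (Finset.range n \ d.support).Nonempty := by
      rw [← Finset.card_pos]
      have h1 := Finset.card_sdiff_add_card_inter d.support (Finset.range n)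
      have h2 := Finset.card_sdiff_add_card_inter (Finset.range n) d.support
      rw [Finset.inter_comm, Finset.card_range] at h2
      omega
    rw [← hs a b d]
    have hsupp : (Finsupp.embDomain (Equiv.swap a b).toEmbedding d).support =
        insert b (d.support.erase a) := by
      rw [Finsupp.support_embDomain]
      ext x
      simp only [Finset.mem_map_equiv, Equiv.symm_swap, Finset.mem_insert,
        Finset.mem_erase]
      simp only [Finset.mem_sdiff] at ha hb
      rw [Equiv.swap_apply_def]
      split_ifs with h1 h2
      · subst h1; simp [hb.2]; rintro rfl; exact hb.2 ha.1
      · subst h2; simp [ha.1]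
      · simp [h1, h2]
    simp only [Finset.mem_sdiff] at ha hb
    apply ih
    · rw [hsupp]
      refine (Finset.card_insert_le _ _).trans ?_
      rw [Finset.card_erase_of_mem ha.1]
      have : 0 < d.support.card := Finset.card_pos.2 ⟨a, ha.1⟩
      omega
    · rw [hsupp, Finset.insert_sdiff_of_mem _ hb.1, Finset.erase_sdiff_comm,
        Finset.card_erase_of_mem (Finset.mem_sdiff.2 ha), hk]
      rfl

theorem card_support_le_degree (d : ℕ →₀ ℕ) : d.support.card ≤ d.degree := by
  rw [Finsupp.degree_apply, Finset.card_eq_sum_ones]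
  exact Finset.sum_le_sum fun i hi => Nat.one_le_iff_ne_zero.2 (Finsupp.mem_support_iff.1 hi)

/-- In degree `n` the first `n` variables decide everything, since a monomial of degree `n` involves
at most `n` of them. The weighted homogeneity obtained here later ensures that every product of
power sums occurring has total degree `n`. -/
theorem exists_powerSumEval_eq (n : ℕ) (f : MvPowerSeries ℕ ℚ) (hf : HomogeneousSeries f n)
    (hs : SwapInvariant f) :
    ∃ P : MvPolynomial ℕ ℚ, P.IsWeightedHomogeneous psWeight n ∧ powerSumEval P = f := by
  classical
  obtain ⟨g, hg⟩ := exists_symmetric_truncation n n f hf hs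
  obtain ⟨q, rfl⟩ := psumAlgHom_surjective n g
  rw [← killCompl_powerSumEval_rename] at hg
  set Q := MvPolynomial.rename (Fin.val : Fin n → ℕ) q
  refine ⟨MvPolynomial.weightedHomogeneousComponent psWeight n Q,
    MvPolynomial.weightedHomogeneousComponent_isWeightedHomogeneous n Q, ?_⟩
  set R := MvPolynomial.weightedHomogeneousComponent psWeight n Q
  have hR : HomogeneousSeries (powerSumEval R) n := homogeneousSeries_powerSumEval n R
    (MvPolynomial.weightedHomogeneousComponent_isWeightedHomogeneous n Q)
  ext d
  by_cases hd : d.degree = n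
  · rw [coeff_powerSumEval_weightedHomogeneousComponent n d hd, ← sub_eq_zero, ← map_sub]
    refine coeff_eq_zero_of_truncation n _ ?_ ?_ _ d ?_ rfl
    · intro a b d
      rw [map_sub, map_sub, hs, swapInvariant_powerSumEval]
    · rw [map_sub, hg, sub_self]
    · rw [← hd]
      exact card_support_le_degree d
  · rw [hf d hd, hR d hd]

/-! ### Bender–Knuth involutions, as reflections of row counts. -/

section BenderKnuth

variable {μ : YoungDiagram}

/-- The number of entries smaller than `v` in row `i`. -/
def rowCount (T : SemistandardYoungTableau μ) (v i : ℕ) : ℕ :=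
  ((Finset.range (μ.rowLen i)).filter fun j => T i j < v).card

theorem lt_rowCount (T : SemistandardYoungTableau μ) (v i j : ℕ) :
    j < rowCount T v i ↔ (i, j) ∈ μ ∧ T i j < v := by
  constructor
  · intro h
    by_contra hn
    refine absurd h (not_lt.2 ?_)
    rw [rowCount, ← Finset.card_range j]
    refine Finset.card_le_card fun k hk => ?_
    rw [Finset.mem_filter, Finset.mem_range, ← YoungDiagram.mem_iff_lt_rowLen] at hk
    rw [Finset.mem_range]
    by_contra hjk
    rw [not_lt] at hjk
    exact hn ⟨μ.up_left_mem le_rfl hjk hk.1, (T.row_weak_of_le hjk hk.1).trans_lt hk.2⟩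
  · rintro ⟨h1, h2⟩
    rw [← Nat.succ_le_iff, rowCount, ← Finset.card_range (Nat.succ j)]
    refine Finset.card_le_card fun k hk => ?_
    rw [Finset.mem_range, Nat.lt_succ_iff] at hk
    rw [Finset.mem_filter, Finset.mem_range, ← YoungDiagram.mem_iff_lt_rowLen]
    exact ⟨μ.up_left_mem le_rfl hk h1, (T.row_weak_of_le hk h1).trans_lt h2⟩

theorem rowCount_mono (T : SemistandardYoungTableau μ) {u v : ℕ} (h : u ≤ v) (i : ℕ) :
    rowCount T u i ≤ rowCount T v i := by
  refine le_of_forall_lt fun j hj => ?_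
  rw [lt_rowCount] at hj ⊢
  exact ⟨hj.1, hj.2.trans_le h⟩

theorem rowCount_succ_le (T : SemistandardYoungTableau μ) (v i : ℕ) :
    rowCount T (v + 1) (i + 1) ≤ rowCount T v i := by
  refine le_of_forall_lt fun j hj => ?_
  rw [lt_rowCount] at hj ⊢
  have := T.col_strict (Nat.lt_add_one i) hj.1
  exact ⟨μ.up_left_mem (Nat.le_succ i) le_rfl hj.1, by omega⟩

/-- The least number of entries at most `v` that row `i` may have. -/
def bkLower (T : SemistandardYoungTableau μ) (v i : ℕ) : ℕ :=
  max (rowCount T v i) (rowCount T (v + 2) (i + 1))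

/-- The greatest number of entries at most `v` that row `i` may have. -/
def bkUpper (T : SemistandardYoungTableau μ) (v : ℕ) : ℕ → ℕ
  | 0 => rowCount T (v + 2) 0
  | i + 1 => min (rowCount T (v + 2) (i + 1)) (rowCount T v i)

/-- Together with `le_bkUpper` this is the interlacing condition on the number of entries at most
`v` in a row. Both bounds depend only on the counts below `v` and below `v + 2`, so the middle count
can be changed in all rows independently. -/
theorem bkLower_le (T : SemistandardYoungTableau μ) (v i : ℕ) :
    bkLower T v i ≤ rowCount T (v + 1) i :=
  max_le (rowCount_mono T (Nat.le_succ v) i) (rowCount_succ_le T (v + 1) i)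

theorem le_bkUpper (T : SemistandardYoungTableau μ) (v i : ℕ) :
    rowCount T (v + 1) i ≤ bkUpper T v i := by
  cases i with
  | zero => exact rowCount_mono T (Nat.le_succ _) 0
  | succ i => exact le_min (rowCount_mono T (Nat.le_succ _) _) (rowCount_succ_le T v i)

theorem bkUpper_le (T : SemistandardYoungTableau μ) (v i : ℕ) :
    bkUpper T v i ≤ rowCount T (v + 2) i := by
  cases i with
  | zero => exact le_rfl
  | succ i => exact min_le_left _ _

/-- The number of entries at most `v` in row `i` after the Bender–Knuth move. -/
def bkCount (T : SemistandardYoungTableau μ) (v i : ℕ) : ℕ :=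
  bkLower T v i + bkUpper T v i - rowCount T (v + 1) i

theorem bkLower_le_bkCount (T : SemistandardYoungTableau μ) (v i : ℕ) :
    bkLower T v i ≤ bkCount T v i := by
  have := le_bkUpper T v i
  unfold bkCount; omega

theorem bkCount_le_bkUpper (T : SemistandardYoungTableau μ) (v i : ℕ) :
    bkCount T v i ≤ bkUpper T v i := by
  have := bkLower_le T v i
  unfold bkCount; omega

open Classical in
/-- The Bender–Knuth involution exchanging the multiplicities of `v` and `v + 1`. -/
noncomputable def benderKnuth (v : ℕ) (T : SemistandardYoungTableau μ) :
    SemistandardYoungTableau μ where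
  entry i j := if (i, j) ∈ μ ∧ v ≤ T i j ∧ T i j ≤ v + 1 then
    if j < bkCount T v i then v else v + 1 else T i j
  row_weak' := by
    intro i j1 j2 hj hc
    have h1 := T.row_weak hj hc
    have h2 := μ.up_left_mem le_rfl hj.le hc
    simp only [hc, h2, true_and]
    split_ifs <;> omega
  col_strict' := by
    intro i1 i2 j hi hc
    have h1 := T.col_strict hi hc
    have h2 := μ.up_left_mem hi.le le_rfl hc
    simp only [hc, h2, true_and]
    -- Column strictness is at risk only where `v` stands above `v + 1`. The two cells are then in
    -- adjacent rows, and the lower bound for the upper row and the upper bound for the lower row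
    -- keep both entries.
    by_cases hboth : T i1 j = v ∧ T i2 j = v + 1
    · have hi2 : i2 = i1 + 1 := by
        by_contra hne
        have h3 := T.col_strict (show i1 + 1 < i2 by omega) hc
        have h4 := T.col_strict (Nat.lt_add_one i1) (μ.up_left_mem (show i1 + 1 ≤ i2 by omega)
          le_rfl hc)
        omega
      subst hi2
      have hj1 : j < bkCount T v i1 := by
        refine lt_of_lt_of_le ?_ (bkLower_le_bkCount T v i1)
        refine lt_of_lt_of_le ?_ (le_max_right _ _)
        rw [lt_rowCount]
        exact ⟨hc, by omega⟩
      have hj2 : ¬ j < bkCount T v (i1 + 1) := by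
        intro h
        have h' := (h.trans_le (bkCount_le_bkUpper T v (i1 + 1))).trans_le (min_le_right _ _)
        rw [lt_rowCount] at h'
        omega
      rw [if_pos (by omega), if_pos hj1, if_pos (by omega), if_neg hj2]
      omega
    · split_ifs <;> omega
  zeros' := by
    intro i j h
    rw [if_neg (fun h' => h h'.1), T.zeros h]

open Classical in
theorem benderKnuth_apply (v : ℕ) (T : SemistandardYoungTableau μ) (i j : ℕ) :
    benderKnuth v T i j = if (i, j) ∈ μ ∧ v ≤ T i j ∧ T i j ≤ v + 1 then
      if j < bkCount T v i then v else v + 1 else T i j := rfl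

theorem rowCount_benderKnuth_of_ne (v u : ℕ) (hu : u ≠ v + 1) (T : SemistandardYoungTableau μ)
    (i : ℕ) : rowCount (benderKnuth v T) u i = rowCount T u i := by
  refine eq_of_forall_lt_iff fun j => ?_
  rw [lt_rowCount, lt_rowCount, benderKnuth_apply]
  refine and_congr_right fun _ => ?_
  split_ifs <;> omega

theorem rowCount_benderKnuth (v : ℕ) (T : SemistandardYoungTableau μ) (i : ℕ) :
    rowCount (benderKnuth v T) (v + 1) i = bkCount T v i := by
  refine eq_of_forall_lt_iff fun j => ?_
  rw [lt_rowCount, benderKnuth_apply]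
  have h1 : j < bkCount T v i → (i, j) ∈ μ ∧ T i j < v + 2 := by
    intro h
    rw [← lt_rowCount]
    exact h.trans_le ((bkCount_le_bkUpper T v i).trans (bkUpper_le T v i))
  have h2 : (i, j) ∈ μ ∧ T i j < v → j < bkCount T v i := by
    intro h
    rw [← lt_rowCount] at h
    exact h.trans_le ((le_max_left _ _).trans (bkLower_le_bkCount T v i))
  constructor
  · rintro ⟨h3, h4⟩
    by_cases h5 : T i j < v
    · exact h2 ⟨h3, h5⟩
    · simp only [h3, true_and] at h4
      split_ifs at h4 <;> omega
  · intro h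
    obtain ⟨h3, h4⟩ := h1 h
    refine ⟨h3, ?_⟩
    simp only [h3, true_and, h, if_true]
    split_ifs <;> omega

/-- The bounds are untouched by the move, so reflecting twice in the same interval restores the
count. -/
theorem bkCount_benderKnuth (v : ℕ) (T : SemistandardYoungTableau μ) (i : ℕ) :
    bkCount (benderKnuth v T) v i = rowCount T (v + 1) i := by
  have hl : bkLower (benderKnuth v T) v i = bkLower T v i := by
    simp [bkLower, rowCount_benderKnuth_of_ne]
  have hu : bkUpper (benderKnuth v T) v i = bkUpper T v i := by
    cases i <;> simp [bkUpper, rowCount_benderKnuth_of_ne]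
  have h1 := bkLower_le T v i
  have h2 := le_bkUpper T v i
  rw [bkCount, hl, hu, rowCount_benderKnuth, bkCount]
  omega

theorem benderKnuth_involutive (v : ℕ) :
    Function.Involutive (benderKnuth v : SemistandardYoungTableau μ → _) := by
  intro T
  ext i j
  rw [benderKnuth_apply, bkCount_benderKnuth]
  by_cases hm : (i, j) ∈ μ
  · simp only [lt_rowCount, hm, true_and]
    rw [benderKnuth_apply]
    simp only [hm, true_and]
    split_ifs <;> omega
  · rw [if_neg (fun h => hm h.1), SemistandardYoungTableau.zeros _ hm,
      SemistandardYoungTableau.zeros _ hm]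

/-- The maximum in row `i` and the minimum in row `i + 1` are taken over the same two numbers, so
they add up to their sum and the total telescopes. -/
theorem sum_bkLower_add_bkUpper (T : SemistandardYoungTableau μ) (v m : ℕ) :
    ∑ i ∈ Finset.range (m + 1), (bkLower T v i + bkUpper T v i) =
      ∑ i ∈ Finset.range m, rowCount T v i + ∑ i ∈ Finset.range (m + 1), rowCount T (v + 2) i +
        max (rowCount T v m) (rowCount T (v + 2) (m + 1)) := by
  induction m with
  | zero => simp [bkLower, bkUpper, add_comm]
  | succ m ih =>
    rw [Finset.sum_range_succ, ih, Finset.sum_range_succ (fun i => rowCount T v i) m,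
      Finset.sum_range_succ (fun i => rowCount T (v + 2) i) (m + 1)]
    have := min_add_max (rowCount T (v + 2) (m + 1)) (rowCount T v m)
    rw [max_comm] at this
    simp only [bkLower, bkUpper]
    omega

/-- The number of cells with an entry smaller than `v`. -/
def countBelow (T : SemistandardYoungTableau μ) (v : ℕ) : ℕ :=
  (μ.cells.filter fun c => T c.1 c.2 < v).card

theorem countBelow_succ (T : SemistandardYoungTableau μ) (v : ℕ) :
    countBelow T (v + 1) = countBelow T v + (μ.cells.filter fun c => T c.1 c.2 = v).card := by
  rw [countBelow, countBelow, ← Finset.card_union_of_disjoint, ← Finset.filter_or]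
  · congr 1
    refine Finset.filter_congr fun c _ => ?_
    omega
  · rw [Finset.disjoint_filter]
    intro c _
    omega

theorem countBelow_eq_sum (T : SemistandardYoungTableau μ) (v M : ℕ) (hM : ∀ c ∈ μ.cells, c.1 < M) :
    countBelow T v = ∑ i ∈ Finset.range M, rowCount T v i := by
  rw [countBelow, Finset.card_eq_sum_card_fiberwise (f := Prod.fst) (t := Finset.range M)]
  · refine Finset.sum_congr rfl fun i _ => ?_
    rw [rowCount]
    symm
    refine Finset.card_bij (fun j _ => (i, j)) ?_ ?_ ?_
    · intro j hj
      rw [Finset.mem_filter, Finset.mem_range, ← YoungDiagram.mem_iff_lt_rowLen] at hj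
      simp [hj]
    · intro j _ k _ h
      simpa using h
    · rintro ⟨a, b⟩ h
      simp only [Finset.mem_filter, YoungDiagram.mem_cells] at h
      obtain ⟨⟨h1, h2⟩, rfl⟩ := h
      refine ⟨b, ?_, rfl⟩
      rw [Finset.mem_filter, Finset.mem_range, ← YoungDiagram.mem_iff_lt_rowLen]
      exact ⟨h1, h2⟩
  · intro c hc
    rw [Finset.mem_coe, Finset.mem_filter] at hc
    exact Finset.mem_coe.2 (Finset.mem_range.2 (hM c hc.1))

/-- Summing the reflections over all rows reflects the total count below `v + 1` between those below
`v` and `v + 2`. This is the exchange of the multiplicities of `v` and `v + 1`. -/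
theorem countBelow_benderKnuth (v : ℕ) (T : SemistandardYoungTableau μ) :
    countBelow (benderKnuth v T) (v + 1) + countBelow T (v + 1) =
      countBelow T v + countBelow T (v + 2) := by
  obtain ⟨m, hm⟩ : ∃ m, ∀ c ∈ μ.cells, c.1 < m + 1 :=
    ⟨μ.cells.sup Prod.fst, fun c hc => Nat.lt_succ_of_le (Finset.le_sup (f := Prod.fst) hc)⟩
  simp only [countBelow_eq_sum _ _ _ hm, rowCount_benderKnuth]
  have h0 : rowCount T (v + 2) (m + 1) = 0 := by
    refine Nat.eq_zero_of_not_pos fun h => ?_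
    rw [lt_rowCount] at h
    exact lt_irrefl _ (hm _ h.1)
  have h := sum_bkLower_add_bkUpper T v m
  rw [h0, Nat.max_zero, add_right_comm, ← Finset.sum_range_succ] at h
  rw [← h, ← Finset.sum_add_distrib]
  refine Finset.sum_congr rfl fun i _ => ?_
  have := le_bkUpper T v i
  rw [bkCount]
  omega

theorem countBelow_benderKnuth_of_ne (v u : ℕ) (hu : u ≠ v + 1) (T : SemistandardYoungTableau μ) :
    countBelow (benderKnuth v T) u = countBelow T u := by
  have hM : ∀ c ∈ μ.cells, c.1 < μ.cells.sup Prod.fst + 1 :=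
    fun c hc => Nat.lt_succ_of_le (Finset.le_sup (f := Prod.fst) hc)
  simp only [countBelow_eq_sum _ _ _ hM, rowCount_benderKnuth_of_ne v u hu]

theorem content_benderKnuth (v i : ℕ) (T : SemistandardYoungTableau μ) :
    (μ.cells.filter fun c => benderKnuth v T c.1 c.2 = i).card =
      (μ.cells.filter fun c => T c.1 c.2 = Equiv.swap v (v + 1) i).card := by
  have h1 := countBelow_succ (benderKnuth v T) i
  have hbk : _ = _ + countBelow T (v + 1 + 1) := countBelow_benderKnuth v T
  have h3 := countBelow_succ T v
  have h4 := countBelow_succ T (v + 1)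
  by_cases hv : i = v
  · subst hv
    rw [Equiv.swap_apply_left]
    rw [countBelow_benderKnuth_of_ne i i (by omega)] at h1
    omega
  · by_cases hv1 : i = v + 1
    · subst hv1
      rw [Equiv.swap_apply_right]
      rw [countBelow_benderKnuth_of_ne v (v + 1 + 1) (by omega)] at h1
      omega
    · rw [Equiv.swap_apply_of_ne_of_ne hv hv1]
      have h2 := countBelow_succ T i
      rw [countBelow_benderKnuth_of_ne v i hv1, countBelow_benderKnuth_of_ne v _ (by omega)] at h1
      omega

end BenderKnuth

/-! ### Symmetry and homogeneity of Schur functions. -/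

theorem coeff_schur (μ : YoungDiagram) (d : ℕ →₀ ℕ) :
    MvPowerSeries.coeff d (schur μ) = (Nat.card {T : SemistandardYoungTableau μ //
      ∀ i : ℕ, (μ.cells.filter fun c => T c.1 c.2 = i).card = d i} : ℚ) := rfl

theorem coeff_schur_adjacent_swap (μ : YoungDiagram) (v : ℕ) (d : ℕ →₀ ℕ) :
    MvPowerSeries.coeff (Finsupp.embDomain (Equiv.swap v (v + 1)).toEmbedding d) (schur μ) =
      MvPowerSeries.coeff d (schur μ) := by
  rw [coeff_schur, coeff_schur]
  congr 1
  refine Nat.card_congr ((benderKnuth_involutive v).toPerm.subtypeEquiv fun T => ?_)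
  rw [Function.Involutive.coe_toPerm]
  simp only [content_benderKnuth]
  have hd : ∀ i, Finsupp.embDomain (Equiv.swap v (v + 1)).toEmbedding d i =
      d (Equiv.swap v (v + 1) i) := by
    intro i
    conv_lhs => rw [show i = (Equiv.swap v (v + 1)).toEmbedding (Equiv.swap v (v + 1) i) by simp]
    rw [Finsupp.embDomain_apply_self]
  simp only [hd]
  constructor
  · intro h i
    rw [h, Equiv.swap_apply_self]
  · intro h i
    have := h (Equiv.swap v (v + 1) i)
    rwa [Equiv.swap_apply_self] at this

theorem swapInvariant_schur (μ : YoungDiagram) : SwapInvariant (schur μ) := by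
  have hmul : ∀ (σ τ : Equiv.Perm ℕ) (d : ℕ →₀ ℕ),
      Finsupp.embDomain (σ * τ).toEmbedding d =
        Finsupp.embDomain σ.toEmbedding (Finsupp.embDomain τ.toEmbedding d) := by
    intro σ τ d
    simp only [Finsupp.embDomain_eq_mapDomain, ← Finsupp.mapDomain_comp]
    rfl
  have key : ∀ k a d, MvPowerSeries.coeff
      (Finsupp.embDomain (Equiv.swap a (a + k + 1)).toEmbedding d) (schur μ) =
      MvPowerSeries.coeff d (schur μ) := by
    intro k
    induction k with
    | zero => exact fun a d => coeff_schur_adjacent_swap μ a d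
    | succ k ih =>
      intro a d
      -- A transposition of distant indices is a conjugate of a closer one by an adjacent
      -- transposition.
      have : Equiv.swap a (a + (k + 1) + 1) = Equiv.swap (a + k + 1) (a + k + 1 + 1) *
          Equiv.swap a (a + k + 1) * Equiv.swap (a + k + 1) (a + k + 1 + 1) := by
        rw [Equiv.swap_mul_swap_mul_swap (by omega) (by omega), Equiv.swap_comm]
        rfl
      rw [this, hmul, hmul, coeff_schur_adjacent_swap, ih, coeff_schur_adjacent_swap]
  intro a b d
  rcases lt_trichotomy a b with h | rfl | h
  · obtain ⟨k, rfl⟩ := Nat.exists_eq_add_of_lt h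
    exact key k a d
  · have : (Equiv.swap a a).toEmbedding = Function.Embedding.refl ℕ := by
      ext; simp
    rw [this, Finsupp.embDomain_refl, id]
  · obtain ⟨k, rfl⟩ := Nat.exists_eq_add_of_lt h
    rw [Equiv.swap_comm]
    exact key k b d

theorem homogeneousSeries_schur (μ : YoungDiagram) : HomogeneousSeries (schur μ) μ.card := by
  intro d hd
  rw [coeff_schur, Nat.cast_eq_zero, Nat.card_eq_zero]
  left
  constructor
  rintro ⟨T, hT⟩
  apply hd
  rw [Finsupp.degree_apply, YoungDiagram.card,
    Finset.card_eq_sum_card_fiberwise (f := fun c : ℕ × ℕ => T c.1 c.2) (t := d.support)]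
  · exact Finset.sum_congr rfl fun i _ => (hT i).symm
  · intro c hc
    rw [Finset.mem_coe, Finsupp.mem_support_iff, ← hT, Finset.card_ne_zero]
    exact ⟨c, by simpa using hc⟩

/-! ### Standardization in an abstract form, applied below to tableaux and to permutations. -/

section Standardization

/-- The index of the block containing `i`, when `B` is the set of the last elements of all blocks
but the final one. -/
def blockIndex (B : Finset ℕ) (i : ℕ) : ℕ := (B.filter (· < i)).card

theorem blockIndex_zero (B : Finset ℕ) : blockIndex B 0 = 0 := by simp [blockIndex]

theorem blockIndex_mono (B : Finset ℕ) {i j : ℕ} (h : i ≤ j) : blockIndex B i ≤ blockIndex B j :=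
  Finset.card_le_card fun x hx => by
    rw [Finset.mem_filter] at hx ⊢
    exact ⟨hx.1, hx.2.trans_le h⟩

theorem blockIndex_succ_of_notMem (B : Finset ℕ) {i : ℕ} (h : i ∉ B) :
    blockIndex B (i + 1) = blockIndex B i := by
  rw [blockIndex, blockIndex]
  congr 1
  refine Finset.filter_congr fun x hx => ?_
  have : x ≠ i := fun h' => h (h' ▸ hx)
  omega

theorem blockIndex_lt_succ_of_mem (B : Finset ℕ) {i : ℕ} (h : i ∈ B) :
    blockIndex B i < blockIndex B (i + 1) := by
  refine Finset.card_lt_card (Finset.ssubset_iff_of_subset ?_ |>.2 ⟨i, ?_, ?_⟩)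
  · intro x hx
    rw [Finset.mem_filter] at hx ⊢
    exact ⟨hx.1, by omega⟩
  · rw [Finset.mem_filter]; exact ⟨h, by omega⟩
  · simp

/-- The sizes of the blocks of `{1, …, n}`. -/
noncomputable def blockContent (n : ℕ) (B : Finset ℕ) : ℕ →₀ ℕ :=
  ∑ i ∈ Finset.Icc 1 n, Finsupp.single (blockIndex B i) 1

theorem blockContent_apply (n : ℕ) (B : Finset ℕ) (j : ℕ) :
    blockContent n B j = ((Finset.Icc 1 n).filter fun i => blockIndex B i = j).card := by
  rw [blockContent, Finsupp.finsetSum_apply, Finset.card_filter]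
  refine Finset.sum_congr rfl fun i _ => ?_
  rw [Finsupp.single_apply]

variable {γ : Type*} (C : Finset γ) (col : γ → ℕ)

/-- The position of `c` in the order by `U` first and by `col` second. -/
def stdRank (U : γ → ℕ) (c : γ) : ℕ :=
  (C.filter fun c' => U c' < U c ∨ U c' = U c ∧ col c' ≤ col c).card

variable {C col}

theorem stdRank_lt {U : γ → ℕ} {c c' : γ} (hc' : c' ∈ C)
    (h : U c < U c' ∨ U c = U c' ∧ col c < col c') : stdRank C col U c < stdRank C col U c' := by
  refine Finset.card_lt_card (Finset.ssubset_iff_of_subset ?_ |>.2 ⟨c', ?_, ?_⟩)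
  · intro x hx
    rw [Finset.mem_filter] at hx ⊢
    exact ⟨hx.1, by omega⟩
  · rw [Finset.mem_filter]; exact ⟨hc', by omega⟩
  · rw [Finset.mem_filter]; omega

theorem stdRank_bijOn {U : γ → ℕ}
    (hinj : ∀ c ∈ C, ∀ c' ∈ C, U c = U c' → col c = col c' → c = c') :
    Set.BijOn (stdRank C col U) (C : Set γ) (Set.Icc 1 C.card) := by
  have hmaps : Set.MapsTo (stdRank C col U) (C : Set γ) (Finset.Icc 1 C.card : Finset ℕ) := by
    intro c hc
    rw [Finset.mem_coe, Finset.mem_Icc]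
    exact ⟨Finset.card_pos.2 ⟨c, by simpa using hc⟩, Finset.card_filter_le _ _⟩
  have hinjOn : Set.InjOn (stdRank C col U) (C : Set γ) := by
    intro c hc c' hc' h
    by_contra hne
    rcases lt_trichotomy (U c) (U c') with h1 | h1 | h1
    · exact (stdRank_lt (col := col) (Finset.mem_coe.1 hc') (Or.inl h1)).ne h
    · rcases lt_trichotomy (col c) (col c') with h2 | h2 | h2
      · exact (stdRank_lt (Finset.mem_coe.1 hc') (Or.inr ⟨h1, h2⟩)).ne h
      · exact hne (hinj c hc c' hc' h1 h2)
      · exact (stdRank_lt (Finset.mem_coe.1 hc) (Or.inr ⟨h1.symm, h2⟩)).ne h.symm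
    · exact (stdRank_lt (col := col) (Finset.mem_coe.1 hc) (Or.inl h1)).ne h.symm
  have hsurj := Finset.surjOn_of_injOn_of_card_le _ hmaps hinjOn (by simp)
  rw [Finset.coe_Icc] at hmaps hsurj
  exact ⟨hmaps, hinjOn, hsurj⟩

theorem blockIndex_lt_iff (n v i : ℕ) (B : Finset ℕ) (hi : i ∈ Finset.Icc 1 n) :
    blockIndex B i < v ↔ i ≤ ((Finset.Icc 1 n).filter fun i => blockIndex B i < v).card := by
  rw [Finset.mem_Icc] at hi
  constructor
  · intro h
    calc i = (Finset.Icc 1 i).card := by simp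
      _ ≤ _ := Finset.card_le_card fun x hx => by
        rw [Finset.mem_Icc] at hx
        rw [Finset.mem_filter, Finset.mem_Icc]
        exact ⟨⟨hx.1, hx.2.trans hi.2⟩, (blockIndex_mono B hx.2).trans_lt h⟩
  · intro h
    by_contra hn
    have : ((Finset.Icc 1 n).filter fun i => blockIndex B i < v).card ≤ (Finset.Icc 1 (i - 1)).card :=
      Finset.card_le_card fun x hx => by
        rw [Finset.mem_filter, Finset.mem_Icc] at hx
        rw [Finset.mem_Icc]
        refine ⟨hx.1.1, ?_⟩
        by_contra hx'
        exact hn ((blockIndex_mono B (by omega)).trans_lt hx.2)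
    rw [Nat.card_Icc] at this
    omega

/-- The rank of `c` exceeds the number of cells with smaller value and is at most the number with
value at most `U c`. Equal contents make these two numbers the ends of the block with index `U c`.
-/
theorem blockIndex_stdRank {U : γ → ℕ} {B : Finset ℕ}
    (hcont : ∀ j, (C.filter fun c => U c = j).card = blockContent C.card B j) {c : γ} (hc : c ∈ C) :
    blockIndex B (stdRank C col U c) = U c := by
  have hcount : ∀ v, (C.filter fun c => U c < v).card =
      ((Finset.Icc 1 C.card).filter fun i => blockIndex B i < v).card := by
    intro v
    rw [Finset.card_eq_sum_card_fiberwise (f := U) (t := Finset.range v) (by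
        intro c hc; simp at hc ⊢; exact hc.2),
      Finset.card_eq_sum_card_fiberwise (f := blockIndex B) (t := Finset.range v) (by
        intro c hc; simp at hc ⊢; exact hc.2)]
    refine Finset.sum_congr rfl fun j hj => ?_
    rw [Finset.mem_range] at hj
    rw [Finset.filter_filter, Finset.filter_filter]
    have h := hcont j
    rw [blockContent_apply] at h
    convert h using 3
    · omega
    · omega
  have hr : stdRank C col U c ∈ Finset.Icc 1 C.card := by
    rw [Finset.mem_Icc]
    exact ⟨Finset.card_pos.2 ⟨c, by simpa using hc⟩, Finset.card_filter_le _ _⟩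
  have h1 : (C.filter fun c' => U c' < U c).card < stdRank C col U c := by
    refine Finset.card_lt_card (Finset.ssubset_iff_of_subset ?_ |>.2 ⟨c, ?_, ?_⟩)
    · intro x hx
      rw [Finset.mem_filter] at hx ⊢
      exact ⟨hx.1, Or.inl hx.2⟩
    · simpa using hc
    · simp
  have h2 : stdRank C col U c ≤ (C.filter fun c' => U c' < U c + 1).card := by
    refine Finset.card_le_card fun x hx => ?_
    rw [Finset.mem_filter] at hx ⊢
    exact ⟨hx.1, by omega⟩
  have h3 := blockIndex_lt_iff C.card (U c) _ B hr
  have h4 := blockIndex_lt_iff C.card (U c + 1) _ B hr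
  rw [← hcount] at h3 h4
  omega

/-- Within one block no intermediate entry lies in `B`, so the adjacent comparisons `hadj` chain
together; the induction is on the gap `k`. -/
theorem col_lt_of_blockIndex_eq {T : γ → ℕ} {B : Finset ℕ} {n : ℕ}
    (hT : Set.BijOn T (C : Set γ) (Set.Icc 1 n))
    (hadj : ∀ c ∈ C, ∀ c' ∈ C, T c' = T c + 1 → T c ∉ B → col c < col c') (k : ℕ) :
    ∀ c ∈ C, ∀ c' ∈ C, T c' = T c + k + 1 → blockIndex B (T c) = blockIndex B (T c') →
      col c < col c' := by
  induction k with
  | zero =>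
    intro c hc c' hc' h hb
    refine hadj c hc c' hc' h fun hB => ?_
    have := blockIndex_lt_succ_of_mem B hB
    rw [h, Nat.add_zero] at hb
    omega
  | succ k ih =>
    intro c hc c' hc' h hb
    have hc1 := hT.mapsTo hc
    have hc2 := hT.mapsTo hc'
    rw [Set.mem_Icc] at hc1 hc2
    obtain ⟨c'', hc'', h'⟩ := hT.surjOn (show T c + k + 1 ∈ Set.Icc 1 n by rw [Set.mem_Icc]; omega)
    have m1 : blockIndex B (T c) ≤ blockIndex B (T c'') := blockIndex_mono B (by omega)
    have m2 : blockIndex B (T c'') ≤ blockIndex B (T c') := blockIndex_mono B (by omega)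
    refine (ih c hc c'' hc'' h' (by omega)).trans (hadj c'' hc'' c' hc' (by omega) fun hB => ?_)
    have := blockIndex_lt_succ_of_mem B hB
    rw [show T c'' + 1 = T c' by omega] at this
    omega

theorem col_lt_of_lt {T : γ → ℕ} {B : Finset ℕ} {n : ℕ}
    (hT : Set.BijOn T (C : Set γ) (Set.Icc 1 n))
    (hadj : ∀ c ∈ C, ∀ c' ∈ C, T c' = T c + 1 → T c ∉ B → col c < col c')
    {c c' : γ} (hc : c ∈ C) (hc' : c' ∈ C) (hlt : T c < T c')
    (hb : blockIndex B (T c) = blockIndex B (T c')) : col c < col c' := by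
  obtain ⟨k, hk⟩ := Nat.exists_eq_add_of_lt hlt
  exact col_lt_of_blockIndex_eq hT hadj k c hc c' hc' hk hb

/-- Inside a block the order by `T` is the order by `col`, so ordering by block and then by `col`
recovers the order by `T`. -/
theorem stdRank_blockIndex {T : γ → ℕ} {B : Finset ℕ} {n : ℕ}
    (hT : Set.BijOn T (C : Set γ) (Set.Icc 1 n))
    (hadj : ∀ c ∈ C, ∀ c' ∈ C, T c' = T c + 1 → T c ∉ B → col c < col c')
    {c : γ} (hc : c ∈ C) : stdRank C col (fun c => blockIndex B (T c)) c = T c := by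
  have hiff : ∀ c' ∈ C, (blockIndex B (T c') < blockIndex B (T c) ∨
      blockIndex B (T c') = blockIndex B (T c) ∧ col c' ≤ col c) ↔ T c' ≤ T c := by
    intro c' hc'
    rcases lt_trichotomy (T c') (T c) with h | h | h
    · have m := blockIndex_mono B h.le
      have := col_lt_of_lt hT hadj hc' hc h
      constructor
      · intro; omega
      · intro _
        by_cases hb : blockIndex B (T c') = blockIndex B (T c)
        · exact Or.inr ⟨hb, (this hb).le⟩
        · omega
    · have := hT.injOn hc' hc h
      subst this
      simp
    · have m := blockIndex_mono B h.le
      have := col_lt_of_lt hT hadj hc hc' h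
      constructor
      · rintro (h1 | ⟨h1, h2⟩)
        · omega
        · have := this h1.symm
          omega
      · intro; omega
  rw [stdRank, Finset.filter_congr hiff]
  have hTc := hT.mapsTo hc
  rw [Set.mem_Icc] at hTc
  calc (C.filter fun c' => T c' ≤ T c).card = (Finset.Icc 1 (T c)).card := by
        refine Finset.card_bij (fun x _ => T x) ?_ ?_ ?_
        · intro x hx
          rw [Finset.mem_filter] at hx
          have := hT.mapsTo (Finset.mem_coe.2 hx.1)
          rw [Set.mem_Icc] at this
          rw [Finset.mem_Icc]
          exact ⟨this.1, hx.2⟩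
        · intro x hx y hy h
          rw [Finset.mem_filter] at hx hy
          exact hT.injOn hx.1 hy.1 h
        · intro i hi
          rw [Finset.mem_Icc] at hi
          obtain ⟨x, hx, rfl⟩ := hT.surjOn (show i ∈ Set.Icc 1 n by rw [Set.mem_Icc]; omega)
          exact ⟨x, Finset.mem_filter.2 ⟨hx, hi.2⟩, rfl⟩
    _ = T c := by simp

theorem content_blockIndex {T : γ → ℕ} {B : Finset ℕ} {n : ℕ}
    (hT : Set.BijOn T (C : Set γ) (Set.Icc 1 n)) (j : ℕ) :
    (C.filter fun c => blockIndex B (T c) = j).card = blockContent n B j := by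
  rw [blockContent_apply]
  refine Finset.card_bij (fun x _ => T x) ?_ ?_ ?_
  · intro x hx
    rw [Finset.mem_filter] at hx
    have := hT.mapsTo (Finset.mem_coe.2 hx.1)
    rw [Finset.mem_filter, Finset.mem_Icc]
    exact ⟨this, hx.2⟩
  · intro x hx y hy h
    rw [Finset.mem_filter] at hx hy
    exact hT.injOn hx.1 hy.1 h
  · intro i hi
    rw [Finset.mem_filter, Finset.mem_Icc] at hi
    obtain ⟨x, hx, rfl⟩ := hT.surjOn (show i ∈ Set.Icc 1 n from hi.1)
    exact ⟨x, Finset.mem_filter.2 ⟨hx, hi.2⟩, rfl⟩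

end Standardization

/-! ### Standard tableaux with bounded descent set as Schur coefficients. -/

section Tableaux

variable {μ : YoungDiagram}

/-- If `i` is not a descent, then `i + 1` is weakly above it. Were it also weakly to the left,
monotonicity along rows and columns would make it the smaller entry. -/
theorem snd_lt_snd_of_descentSet_subset {T : SemistandardYoungTableau μ} {B : Finset ℕ}
    (hD : descentSet T ⊆ B) : ∀ c ∈ μ.cells, ∀ c' ∈ μ.cells, T c'.1 c'.2 = T c.1 c.2 + 1 →
      T c.1 c.2 ∉ B → c.2 < c'.2 := by
  intro c hc c' hc' h hB
  rw [YoungDiagram.mem_cells] at hc hc'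
  by_contra hcol
  rw [not_lt] at hcol
  have hrow : c'.1 ≤ c.1 := by
    by_contra hrow
    exact hB (hD ⟨c, hc, c', hc', rfl, h, not_le.1 hrow⟩)
  have h1 := T.row_weak_of_le hcol (μ.up_left_mem hrow le_rfl hc)
  have h2 := T.col_weak hrow hc
  omega

/-- Replacing every entry of a standard tableau by the index of its block. -/
def destandardize (B : Finset ℕ) (T : SemistandardYoungTableau μ) (hT : IsStandard T)
    (hD : descentSet T ⊆ B) : SemistandardYoungTableau μ where
  entry i j := blockIndex B (T i j)
  row_weak' hj hc := blockIndex_mono B (T.row_weak hj hc)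
  col_strict' := by
    intro i1 i2 j hi hc
    have h := T.col_strict hi hc
    refine lt_of_le_of_ne (blockIndex_mono B h.le) fun hb => ?_
    exact lt_irrefl _ (col_lt_of_lt (C := μ.cells) (col := Prod.snd)
      (T := fun c : ℕ × ℕ => T c.1 c.2) hT
      (snd_lt_snd_of_descentSet_subset hD) (c := (i1, j)) (c' := (i2, j))
      (μ.up_left_mem hi.le le_rfl hc) hc h hb)
  zeros' h := by rw [T.zeros h, blockIndex_zero]

theorem snd_injective_of_eq (U : SemistandardYoungTableau μ) : ∀ c ∈ μ.cells, ∀ c' ∈ μ.cells,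
    U c.1 c.2 = U c'.1 c'.2 → c.2 = c'.2 → c = c' := by
  rintro ⟨i, j⟩ hc ⟨i', j'⟩ hc' h (rfl : j = j')
  rw [YoungDiagram.mem_cells] at hc hc'
  rcases lt_trichotomy i i' with hlt | rfl | hlt
  · exact absurd h (U.col_strict hlt hc').ne
  · rfl
  · exact absurd h (U.col_strict hlt hc).ne'

open Classical in
/-- The standardization of a semistandard tableau. -/
noncomputable def standardize (U : SemistandardYoungTableau μ) : SemistandardYoungTableau μ where
  entry i j := if (i, j) ∈ μ then stdRank μ.cells Prod.snd (fun c => U c.1 c.2) (i, j) else 0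
  row_weak' := by
    intro i j1 j2 hj hc
    have h2 := μ.up_left_mem le_rfl hj.le hc
    rw [if_pos hc, if_pos h2]
    refine (stdRank_lt hc ?_).le
    have := U.row_weak hj hc
    show U i j1 < U i j2 ∨ U i j1 = U i j2 ∧ j1 < j2
    omega
  col_strict' := by
    intro i1 i2 j hi hc
    rw [if_pos hc, if_pos (μ.up_left_mem hi.le le_rfl hc)]
    exact stdRank_lt hc (Or.inl (U.col_strict hi hc))
  zeros' h := if_neg h

theorem standardize_apply (U : SemistandardYoungTableau μ) {c : ℕ × ℕ} (hc : c ∈ μ.cells) :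
    standardize U c.1 c.2 = stdRank μ.cells Prod.snd (fun c => U c.1 c.2) c := if_pos hc

theorem isStandard_standardize (U : SemistandardYoungTableau μ) : IsStandard (standardize U) :=
  (stdRank_bijOn (snd_injective_of_eq U)).congr fun _ hc =>
    (standardize_apply U (Finset.mem_coe.1 hc)).symm

theorem descentSet_standardize_subset (U : SemistandardYoungTableau μ) {B : Finset ℕ}
    (hcont : ∀ j, (μ.cells.filter fun c => U c.1 c.2 = j).card = blockContent μ.card B j) :
    descentSet (standardize U) ⊆ B := by
  rintro i ⟨c, hc, c', hc', h, h', hrow⟩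
  rw [← YoungDiagram.mem_cells] at hc hc'
  by_contra hB
  rw [standardize_apply U hc] at h
  rw [standardize_apply U hc'] at h'
  have hU := blockIndex_stdRank (col := Prod.snd) (U := fun c : ℕ × ℕ => U c.1 c.2) hcont hc
  have hU' := blockIndex_stdRank (col := Prod.snd) (U := fun c : ℕ × ℕ => U c.1 c.2) hcont hc'
  rw [h] at hU
  rw [h', blockIndex_succ_of_notMem B hB, hU] at hU'
  have hcol : c.2 ≤ c'.2 := by
    by_contra hcol
    have := stdRank_lt (col := Prod.snd) (U := fun c : ℕ × ℕ => U c.1 c.2) hc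
      (Or.inr ⟨hU'.symm, not_le.1 hcol⟩)
    omega
  have h1 := U.row_weak_of_le hcol (μ.up_left_mem hrow.le le_rfl hc')
  have h2 := U.col_strict hrow hc'
  omega

/-- `destandardize` and `standardize` are inverse to each other. Block indices start at `0`,
matching the first variable `x₀`. -/
theorem card_standard_descentSet_subset (μ : YoungDiagram) (B : Finset ℕ) :
    (Nat.card {T : SemistandardYoungTableau μ // IsStandard T ∧ descentSet T ⊆ B} : ℚ) =
      MvPowerSeries.coeff (blockContent μ.card B) (schur μ) := by
  rw [coeff_schur]
  congr 1
  let f : {T : SemistandardYoungTableau μ // IsStandard T ∧ descentSet T ⊆ B} →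
      {T : SemistandardYoungTableau μ // ∀ i : ℕ,
        (μ.cells.filter fun c => T c.1 c.2 = i).card = blockContent μ.card B i} :=
    fun T => ⟨destandardize B T.1 T.2.1 T.2.2, content_blockIndex T.2.1⟩
  refine Nat.card_congr (Equiv.ofBijective f ⟨?_, ?_⟩)
  · rintro ⟨T, hT, hD⟩ ⟨T', hT', hD'⟩ h
    have h' : ∀ i j, blockIndex B (T i j) = blockIndex B (T' i j) := fun i j =>
      congrArg (fun U => U.1 i j) h
    apply Subtype.ext
    ext i j
    by_cases hm : (i, j) ∈ μ
    · have e1 := stdRank_blockIndex (C := μ.cells) (col := Prod.snd) (B := B)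
        (T := fun c : ℕ × ℕ => T c.1 c.2) hT (snd_lt_snd_of_descentSet_subset hD) (c := (i, j)) hm
      have e2 := stdRank_blockIndex (C := μ.cells) (col := Prod.snd) (B := B)
        (T := fun c : ℕ × ℕ => T' c.1 c.2) hT' (snd_lt_snd_of_descentSet_subset hD')
        (c := (i, j)) hm
      simp only [h'] at e1
      exact e1.symm.trans e2
    · show T i j = T' i j
      rw [T.zeros hm, T'.zeros hm]
  · rintro ⟨U, hU⟩
    refine ⟨⟨standardize U, isStandard_standardize U, descentSet_standardize_subset U hU⟩, ?_⟩
    apply Subtype.ext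
    ext i j
    show blockIndex B (standardize U i j) = U i j
    by_cases hm : (i, j) ∈ μ
    · rw [show standardize U i j = _ from standardize_apply U (c := (i, j)) hm]
      exact blockIndex_stdRank (col := Prod.snd) (U := fun c : ℕ × ℕ => U c.1 c.2) hU hm
    · rw [U.zeros hm, (standardize U).zeros hm, blockIndex_zero]

end Tableaux

/-! ### The same count for permutations, with `p₁ ^ n` in place of a Schur function. -/

section Permutations

theorem bijOn_symm_add_one {n : ℕ} (w : Equiv.Perm (Fin n)) :
    Set.BijOn (fun c => (w.symm c : ℕ) + 1) (Finset.univ : Finset (Fin n)) (Set.Icc 1 n) := by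
  refine ⟨fun c _ => ?_, fun c _ c' _ h => ?_, fun i hi => ?_⟩
  · rw [Set.mem_Icc]
    have := (w.symm c).2
    show 1 ≤ (w.symm c : ℕ) + 1 ∧ (w.symm c : ℕ) + 1 ≤ n
    omega
  · exact w.symm.injective (Fin.ext (Nat.succ_injective h))
  · rw [Set.mem_Icc] at hi
    refine ⟨w ⟨i - 1, by omega⟩, by simp, ?_⟩
    show (w.symm (w _) : ℕ) + 1 = i
    rw [Equiv.symm_apply_apply]
    show i - 1 + 1 = i
    omega

theorem val_lt_val_of_permDescentSet_subset {n : ℕ} {w : Equiv.Perm (Fin n)} {B : Finset ℕ}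
    (hD : permDescentSet w ⊆ B) : ∀ c ∈ (Finset.univ : Finset (Fin n)),
      ∀ c' ∈ (Finset.univ : Finset (Fin n)), (w.symm c' : ℕ) + 1 = (w.symm c : ℕ) + 1 + 1 →
        (w.symm c : ℕ) + 1 ∉ B → (c : ℕ) < c' := by
  intro c _ c' _ h hB
  by_contra hlt
  obtain ⟨a, rfl⟩ := w.surjective c
  obtain ⟨b, rfl⟩ := w.surjective c'
  rw [Equiv.symm_apply_apply] at hB
  rw [Equiv.symm_apply_apply, Equiv.symm_apply_apply] at h
  have hb : b = ⟨(a : ℕ) + 1, by have := b.2; omega⟩ := Fin.ext (by simpa using h)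
  have hne : w b ≠ w a := fun h' => by
    have := w.injective h'
    rw [this] at h
    omega
  refine hB (hD ⟨a, by have := b.2; omega, rfl, ?_⟩)
  rw [← hb]
  exact lt_of_le_of_ne (not_lt.1 hlt) hne

/-- Here the cells are the letters, the tableau entry of a letter is its position, and `col` is its
value. Such a permutation increases along each block, so it is determined by the block to which each
letter goes. -/
theorem card_permDescentSet_subset (n : ℕ) (B : Finset ℕ) :
    Nat.card {w : Equiv.Perm (Fin n) // permDescentSet w ⊆ B} =
      Nat.card {U : Fin n → ℕ // ∀ i,
        (Finset.univ.filter fun c => U c = i).card = blockContent n B i} := by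
  let f : {w : Equiv.Perm (Fin n) // permDescentSet w ⊆ B} →
      {U : Fin n → ℕ // ∀ i, (Finset.univ.filter fun c => U c = i).card = blockContent n B i} :=
    fun w => ⟨fun c => blockIndex B ((w.1.symm c : ℕ) + 1),
      content_blockIndex (bijOn_symm_add_one w.1)⟩
  refine Nat.card_congr (Equiv.ofBijective f ⟨?_, ?_⟩)
  · rintro ⟨w, hw⟩ ⟨w', hw'⟩ h
    have h' : ∀ c, blockIndex B ((w.symm c : ℕ) + 1) = blockIndex B ((w'.symm c : ℕ) + 1) := fun c =>
      congrArg (fun U => U.1 c) h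
    apply Subtype.ext
    show w = w'
    rw [← Equiv.symm_bijective.injective.eq_iff]
    ext c
    have e1 := stdRank_blockIndex (B := B) (col := Fin.val) (bijOn_symm_add_one w)
      (val_lt_val_of_permDescentSet_subset hw) (Finset.mem_univ c)
    have e2 := stdRank_blockIndex (B := B) (col := Fin.val) (bijOn_symm_add_one w')
      (val_lt_val_of_permDescentSet_subset hw') (Finset.mem_univ c)
    simp only [h'] at e1
    exact Nat.succ_injective (e1.symm.trans e2)
  · rintro ⟨U, hU⟩
    have hbij := stdRank_bijOn (C := (Finset.univ : Finset (Fin n))) (col := Fin.val) (U := U)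
      (fun c _ c' _ _ h => Fin.ext h)
    rw [Finset.card_fin] at hbij
    have hmem : ∀ c, 1 ≤ stdRank Finset.univ Fin.val U c ∧ stdRank Finset.univ Fin.val U c ≤ n :=
      fun c => hbij.mapsTo (Finset.mem_coe.2 (Finset.mem_univ c))
    let g : Fin n → Fin n := fun c =>
      ⟨stdRank Finset.univ Fin.val U c - 1, by have := hmem c; omega⟩
    have hg : Function.Injective g := by
      intro c c' h
      have h1 := hmem c
      have h2 := hmem c'
      have h3 : stdRank Finset.univ Fin.val U c - 1 = stdRank Finset.univ Fin.val U c' - 1 :=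
        congrArg Fin.val h
      exact hbij.injOn (by simp) (by simp) (by omega)
    let e : Equiv.Perm (Fin n) := Equiv.ofBijective g (Finite.injective_iff_bijective.1 hg)
    have he : ∀ c, (e c : ℕ) + 1 = stdRank Finset.univ Fin.val U c := by
      intro c
      have := hmem c
      show stdRank Finset.univ Fin.val U c - 1 + 1 = _
      omega
    have hU' : ∀ c, blockIndex B ((e c : ℕ) + 1) = U c := fun c => by
      rw [he]
      refine blockIndex_stdRank ?_ (Finset.mem_univ c)
      rwa [Finset.card_fin]
    refine ⟨⟨e.symm, ?_⟩, Subtype.ext (funext hU')⟩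
    rintro i ⟨j, hj, rfl, hlt⟩
    by_contra hB
    have h1 := he (e.symm ⟨j, by omega⟩)
    have h2 := he (e.symm ⟨j + 1, hj⟩)
    have h3 := hU' (e.symm ⟨j, by omega⟩)
    have h4 := hU' (e.symm ⟨j + 1, hj⟩)
    simp only [Equiv.apply_symm_apply] at h1 h2 h3 h4
    rw [blockIndex_succ_of_notMem B hB, h3] at h4
    have := stdRank_lt (C := Finset.univ) (col := Fin.val) (U := U)
      (Finset.mem_univ (e.symm ⟨j, by omega⟩)) (Or.inr ⟨h4.symm, hlt⟩)
    omega

theorem coeff_powerSum_one_pow (n : ℕ) (d : ℕ →₀ ℕ) :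
    MvPowerSeries.coeff d (powerSum 1 ^ n) =
      Nat.card {U : Fin n → ℕ // ∀ i, (Finset.univ.filter fun c => U c = i).card = d i} := by
  classical
  obtain ⟨N, hN⟩ := d.support.exists_nat_subset_range
  obtain ⟨d, rfl⟩ : d ∈ Set.range (Finsupp.embDomain (M := ℕ) (Fin.valEmbedding (n := N))) := by
    rw [Finsupp.mem_range_embDomain_iff]
    intro x hx
    exact ⟨⟨x, Finset.mem_range.1 (hN hx)⟩, rfl⟩
  rw [← MvPowerSeries.coeff_killCompl, map_pow, killCompl_powerSum N 1 one_ne_zero,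
    MvPolynomial.psum_one, ← MvPolynomial.coe_pow, MvPolynomial.coeff_coe]
  have hpow : (∑ i : Fin N, MvPolynomial.X (R := ℚ) i) ^ n =
      ∑ U : Fin n → Fin N, MvPolynomial.monomial (∑ c, Finsupp.single (U c) 1) (1 : ℚ) := by
    rw [← Finset.card_fin n, ← Finset.prod_const, Finset.prod_univ_sum, Finset.card_fin,
      Fintype.piFinset_univ]
    refine Finset.sum_congr rfl fun U _ => ?_
    rw [MvPolynomial.monomial_sum_one]
    rfl
  rw [hpow, MvPolynomial.coeff_sum]
  simp_rw [MvPolynomial.coeff_monomial]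
  rw [Finset.sum_boole, ← Fintype.card_subtype, ← Nat.card_eq_fintype_card]
  congr 1
  have hcount : ∀ (U : Fin n → Fin N) i, (∑ c, Finsupp.single (U c) 1 : Fin N →₀ ℕ) i =
      (Finset.univ.filter fun c => U c = i).card := by
    intro U i
    rw [Finsupp.finsetSum_apply, Finset.card_filter]
    exact Finset.sum_congr rfl fun c _ => Finsupp.single_apply
  let f : {U : Fin n → Fin N // ∑ c, Finsupp.single (U c) 1 = d} →
      {U : Fin n → ℕ // ∀ i, (Finset.univ.filter fun c => U c = i).card =
        Finsupp.embDomain Fin.valEmbedding d i} := fun U => ⟨fun c => U.1 c, by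
    intro i
    by_cases hi : i < N
    · have h := Finsupp.embDomain_apply_self (Fin.valEmbedding (n := N)) d ⟨i, hi⟩
      rw [Fin.valEmbedding_apply] at h
      rw [h, ← DFunLike.congr_fun U.2 ⟨i, hi⟩, hcount]
      simp only [Fin.ext_iff]
    · rw [Finsupp.embDomain_of_notMem_range, Finset.card_eq_zero, Finset.filter_eq_empty_iff]
      · intro c _ hc
        exact hi (hc ▸ (U.1 c).2)
      · rintro ⟨x, rfl⟩
        exact hi x.2⟩
  refine Nat.card_congr (Equiv.ofBijective f ⟨?_, ?_⟩)
  · intro U U' h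
    apply Subtype.ext
    funext c
    exact Fin.ext (congrArg (fun V => V.1 c) h)
  · rintro ⟨U, hU⟩
    have hlt : ∀ c, U c < N := by
      intro c
      by_contra hc
      have h := hU (U c)
      rw [Finsupp.embDomain_of_notMem_range, Finset.card_eq_zero, Finset.filter_eq_empty_iff] at h
      · exact h (Finset.mem_univ c) rfl
      · rintro ⟨x, hx⟩
        exact hc (hx ▸ x.2)
    refine ⟨⟨fun c => ⟨U c, hlt c⟩, ?_⟩, rfl⟩
    ext i
    rw [hcount, ← Finsupp.embDomain_apply_self (Fin.valEmbedding (n := N)) d i, ← hU]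
    simp [Fin.ext_iff]

end Permutations

/-! ### Inclusion–exclusion and the ribbon functional. -/

theorem card_eq_sum_powerset {X : Type*} [Finite X] (D : X → Set ℕ) (S : Finset ℕ) :
    (Nat.card {x // D x = S} : ℚ) =
      ∑ B ∈ S.powerset, (-1) ^ (S \ B).card * (Nat.card {x // D x ⊆ B} : ℚ) := by
  classical
  have := Fintype.ofFinite X
  simp_rw [Nat.card_eq_fintype_card, Fintype.card_subtype, ← Finset.sum_boole, Finset.mul_sum]
  rw [Finset.sum_comm]
  refine Finset.sum_congr rfl fun x _ => ?_
  by_cases hx : D x ⊆ S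
  · have h := Finset.prod_add (fun _ : ℕ => (1 : ℚ)) (fun s => if s ∈ D x then 0 else -1) S
    have hl : (if D x = ↑S then 1 else 0 : ℚ) =
        ∏ s ∈ S, (1 + if s ∈ D x then (0 : ℚ) else -1) := by
      split_ifs with hS
      · refine (Finset.prod_eq_one fun s hs => ?_).symm
        rw [if_pos (hS ▸ Finset.mem_coe.2 hs), add_zero]
      · obtain ⟨s, hs, hs'⟩ : ∃ s ∈ S, s ∉ D x := by
          by_contra! hall
          exact hS (hx.antisymm fun s hs => hall s hs)
        refine (Finset.prod_eq_zero hs ?_).symm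
        rw [if_neg hs']
        norm_num
    rw [hl, h]
    refine Finset.sum_congr rfl fun B hB => ?_
    rw [Finset.prod_const_one, one_mul]
    split_ifs with hDB
    · rw [mul_one, ← Finset.prod_const]
      refine Finset.prod_congr rfl fun s hs => ?_
      rw [Finset.mem_sdiff] at hs
      exact if_neg fun h => hs.2 (hDB h)
    · rw [mul_zero]
      obtain ⟨s, hs, hs'⟩ := Set.not_subset.1 hDB
      exact Finset.prod_eq_zero (Finset.mem_sdiff.2 ⟨hx hs, hs'⟩) (if_pos hs)
  · rw [if_neg (fun h => hx h.le)]
    refine (Finset.sum_eq_zero fun B hB => ?_).symm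
    rw [if_neg, mul_zero]
    exact fun h => hx (h.trans (Finset.coe_subset.2 (Finset.mem_powerset.1 hB)))

/-- The pairing of `f` with the ribbon Schur function of size `n` and descent set `S`. -/
noncomputable def ribbonPairing (n : ℕ) (S : Finset ℕ) : MvPowerSeries ℕ ℚ →ₗ[ℚ] ℚ :=
  ∑ B ∈ S.powerset, (-1 : ℚ) ^ (S \ B).card • MvPowerSeries.coeff (blockContent n B)

theorem ribbonPairing_apply (n : ℕ) (S : Finset ℕ) (f : MvPowerSeries ℕ ℚ) :
    ribbonPairing n S f =
      ∑ B ∈ S.powerset, (-1 : ℚ) ^ (S \ B).card * MvPowerSeries.coeff (blockContent n B) f := by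
  simp [ribbonPairing]

theorem finite_isStandard (μ : YoungDiagram) :
    Finite {T : SemistandardYoungTableau μ // IsStandard T} := by
  let f : {T : SemistandardYoungTableau μ // IsStandard T} → (μ.cells → Fin (μ.card + 1)) :=
    fun T c => ⟨T.1 c.1.1 c.1.2, by
      have := T.2.mapsTo (Finset.mem_coe.2 c.2)
      rw [Set.mem_Icc] at this
      exact Nat.lt_succ_of_le this.2⟩
  refine Finite.of_injective f ?_
  intro T T' h
  apply Subtype.ext
  ext i j
  by_cases hm : (i, j) ∈ μ
  · exact congrArg Fin.val (congrFun h ⟨(i, j), hm⟩)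
  · rw [T.1.zeros hm, T'.1.zeros hm]

theorem ribbonPairing_schur (μ : YoungDiagram) (S : Finset ℕ) :
    (Nat.card {T : SemistandardYoungTableau μ // IsStandard T ∧ descentSet T = S} : ℚ) =
      ribbonPairing μ.card S (schur μ) := by
  have := finite_isStandard μ
  rw [ribbonPairing_apply, ← Nat.card_congr (Equiv.subtypeSubtypeEquivSubtypeInter _ _),
    card_eq_sum_powerset fun T : {T : SemistandardYoungTableau μ // IsStandard T} => descentSet T.1]
  refine Finset.sum_congr rfl fun B _ => ?_
  rw [← card_standard_descentSet_subset, ← Nat.card_congr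
    (Equiv.subtypeSubtypeEquivSubtypeInter (fun T : SemistandardYoungTableau μ => IsStandard T)
      fun T => descentSet T ⊆ B)]

theorem ribbonPairing_powerSum_one_pow (n : ℕ) (S : Finset ℕ) :
    (Nat.card {w : Equiv.Perm (Fin n) // permDescentSet w = S} : ℚ) =
      ribbonPairing n S (powerSum 1 ^ n) := by
  rw [ribbonPairing_apply, card_eq_sum_powerset permDescentSet]
  refine Finset.sum_congr rfl fun B _ => ?_
  rw [coeff_powerSum_one_pow, card_permDescentSet_subset]

/-! ### Coefficients of products of power sums, one variable at a time. -/

/-- The embedding of the variables `x₀, x₁, …` as `x₁, x₂, …`. -/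
def succEmbedding : ℕ ↪ ℕ := ⟨Nat.succ, Nat.succ_injective⟩

/-- The content obtained by prepending a block of size `t`. -/
noncomputable def consContent (t : ℕ) (d : ℕ →₀ ℕ) : ℕ →₀ ℕ :=
  Finsupp.single 0 t + Finsupp.embDomain succEmbedding d

theorem embDomain_succ_apply_zero (d : ℕ →₀ ℕ) : Finsupp.embDomain succEmbedding d 0 = 0 :=
  Finsupp.embDomain_of_notMem_range _ _ _ (by rintro ⟨x, hx⟩; exact Nat.succ_ne_zero x hx)

theorem mem_range_embDomain_succ {d : ℕ →₀ ℕ} (h : d 0 = 0) :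
    ∃ x : ℕ →₀ ℕ, Finsupp.embDomain succEmbedding x = d := by
  rw [← Set.mem_range, Finsupp.mem_range_embDomain_iff]
  intro i hi
  cases i with
  | zero => exact absurd h (Finsupp.mem_support_iff.1 hi)
  | succ i => exact ⟨i, rfl⟩

theorem coeff_rename_succ_of_ne_zero (f : MvPowerSeries ℕ ℚ) {d : ℕ →₀ ℕ} (h : d 0 ≠ 0) :
    MvPowerSeries.coeff d (MvPowerSeries.rename succEmbedding f) = 0 := by
  apply MvPowerSeries.coeff_rename_eq_zero
  rintro ⟨x, rfl⟩
  rw [← Finsupp.embDomain_eq_mapDomain] at h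
  exact h (embDomain_succ_apply_zero x)

theorem powerSum_eq_X_pow_add_rename {k : ℕ} (hk : k ≠ 0) :
    powerSum k = MvPowerSeries.X 0 ^ k + MvPowerSeries.rename succEmbedding (powerSum k) := by
  classical
  ext d
  rw [map_add, MvPowerSeries.coeff_X_pow]
  by_cases h0 : d 0 = 0
  · obtain ⟨x, rfl⟩ := mem_range_embDomain_succ h0
    rw [MvPowerSeries.coeff_embDomain_rename, if_neg, zero_add, coeff_powerSum, coeff_powerSum]
    · congr 1
      rw [eq_iff_iff]
      constructor
      · rintro ⟨i, hi⟩
        cases i with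
        | zero =>
          rw [hi, Finsupp.single_eq_same] at h0
          exact absurd h0 hk
        | succ i =>
          refine ⟨i, Finsupp.embDomain_injective succEmbedding ?_⟩
          rw [hi, Finsupp.embDomain_single]
          rfl
      · rintro ⟨i, rfl⟩
        exact ⟨i + 1, by rw [Finsupp.embDomain_single]; rfl⟩
    · intro h
      rw [h, Finsupp.single_eq_same] at h0
      exact hk h0
  · rw [coeff_rename_succ_of_ne_zero _ h0, add_zero, coeff_powerSum]
    congr 1
    rw [eq_iff_iff]
    constructor
    · rintro ⟨i, rfl⟩
      rcases eq_or_ne i 0 with rfl | hi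
      · rfl
      · rw [Finsupp.single_eq_of_ne hi.symm] at h0
        exact absurd rfl h0
    · rintro rfl
      exact ⟨0, rfl⟩

theorem coeff_consContent_X_pow_mul_rename (t a : ℕ) (d : ℕ →₀ ℕ) (g : MvPowerSeries ℕ ℚ) :
    MvPowerSeries.coeff (consContent t d)
      (MvPowerSeries.X 0 ^ a * MvPowerSeries.rename succEmbedding g) =
      if a = t then MvPowerSeries.coeff d g else 0 := by
  classical
  rw [MvPowerSeries.X_pow_eq, MvPowerSeries.coeff_monomial_mul, one_mul]
  split_ifs with h1 h2 h2
  · subst h2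
    rw [consContent, add_tsub_cancel_left, MvPowerSeries.coeff_embDomain_rename]
  · apply coeff_rename_succ_of_ne_zero
    have := h1 0
    simp only [consContent, Finsupp.add_apply, Finsupp.tsub_apply, Finsupp.single_eq_same,
      embDomain_succ_apply_zero] at this ⊢
    omega
  · subst h2
    exact absurd (le_add_right le_rfl) h1
  · rfl

theorem sum_weights_lt_iff {κ : Type*} (w : κ → ℕ) (hw : ∀ i, w i ≠ 0) {I J : Finset κ} (hJ : J ⊆ I) :
    ∑ i ∈ J, w i < ∑ i ∈ I, w i ↔ J ≠ I := by
  constructor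
  · rintro h rfl
    exact lt_irrefl _ h
  · intro h
    obtain ⟨i, hi, hiJ⟩ := Finset.exists_of_ssubset (hJ.ssubset_of_ne h)
    exact Finset.sum_lt_sum_of_subset hJ hi hiJ (Nat.pos_of_ne_zero (hw i)) fun _ _ _ =>
      Nat.zero_le _

theorem one_le_sum_weights_iff {κ : Type*} (w : κ → ℕ) (hw : ∀ i, w i ≠ 0) (J : Finset κ) :
    1 ≤ ∑ i ∈ J, w i ↔ J ≠ ∅ := by
  have := sum_weights_lt_iff w hw (Finset.empty_subset J)
  rw [Finset.sum_empty] at this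
  rw [Nat.one_le_iff_ne_zero, ← Nat.pos_iff_ne_zero, this, ne_comm]

variable {ι : Type*} [DecidableEq ι]

/-- Each factor contributes either its power of `x₀` or a power sum in the remaining variables; `J`
collects the factors of the first kind. -/
theorem coeff_consContent_prod_powerSum (w : ι → ℕ) (hw : ∀ i, w i ≠ 0) (I : Finset ι) (t : ℕ)
    (d : ℕ →₀ ℕ) : MvPowerSeries.coeff (consContent t d) (∏ i ∈ I, powerSum (w i)) =
      ∑ J ∈ I.powerset, if ∑ i ∈ J, w i = t then
        MvPowerSeries.coeff d (∏ i ∈ I \ J, powerSum (w i)) else 0 := by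
  rw [Finset.prod_congr rfl fun i _ => powerSum_eq_X_pow_add_rename (hw i), Finset.prod_add,
    map_sum]
  refine Finset.sum_congr rfl fun J _ => ?_
  rw [Finset.prod_pow_eq_pow_sum, ← map_prod, coeff_consContent_X_pow_mul_rename]

theorem coeff_single_prod_powerSum (w : ι → ℕ) (hw : ∀ i, w i ≠ 0) (I : Finset ι) :
    MvPowerSeries.coeff (Finsupp.single 0 (∑ i ∈ I, w i)) (∏ i ∈ I, powerSum (w i)) = 1 := by
  have h := coeff_consContent_prod_powerSum w hw I (∑ i ∈ I, w i) 0
  rw [consContent, Finsupp.embDomain_zero, add_zero] at h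
  rw [h, Finset.sum_eq_single I]
  · simp
  · intro J hJ hne
    rw [if_neg]
    intro hs
    apply hne
    rw [Finset.mem_powerset] at hJ
    refine hJ.antisymm fun i hi => ?_
    by_contra hiJ
    have := Finset.sum_lt_sum_of_subset hJ hi hiJ (Nat.pos_of_ne_zero (hw i)) (fun _ _ _ =>
      Nat.zero_le _)
    omega
  · simp

/-! ### Splitting off the first block of a set of positions. -/

/-- The set of partial sums obtained by prepending a block of size `t`. -/
def consBlock (t : ℕ) (B : Finset ℕ) : Finset ℕ := insert t (B.map (addRightEmbedding t))

theorem mem_consBlock {t x : ℕ} {B : Finset ℕ} :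
    x ∈ consBlock t B ↔ x = t ∨ ∃ y ∈ B, y + t = x := by
  simp [consBlock]

theorem card_consBlock {t : ℕ} {B : Finset ℕ} (hB : ∀ x ∈ B, 0 < x) :
    (consBlock t B).card = B.card + 1 := by
  rw [consBlock, Finset.card_insert_of_notMem, Finset.card_map]
  intro h
  rw [Finset.mem_map] at h
  obtain ⟨x, hx, h⟩ := h
  have := hB x hx
  rw [addRightEmbedding_apply] at h
  omega

theorem blockIndex_consBlock_of_le {t i : ℕ} (B : Finset ℕ) (hi : i ≤ t) :
    blockIndex (consBlock t B) i = 0 := by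
  rw [blockIndex, Finset.card_eq_zero, Finset.filter_eq_empty_iff]
  intro x hx
  rw [mem_consBlock] at hx
  rcases hx with rfl | ⟨y, _, rfl⟩ <;> omega

theorem blockIndex_consBlock_add {t i : ℕ} {B : Finset ℕ} (hB : ∀ x ∈ B, 0 < x) (hi : 0 < i) :
    blockIndex (consBlock t B) (i + t) = blockIndex B i + 1 := by
  rw [blockIndex, blockIndex, ← card_consBlock (t := t) fun x hx => hB x (Finset.mem_filter.1 hx).1]
  congr 1
  ext x
  simp only [Finset.mem_filter, mem_consBlock]
  constructor
  · rintro ⟨rfl | ⟨y, hy, rfl⟩, hx⟩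
    · exact Or.inl rfl
    · exact Or.inr ⟨y, ⟨hy, by omega⟩, rfl⟩
  · rintro (rfl | ⟨y, ⟨hy, hlt⟩, rfl⟩)
    · exact ⟨Or.inl rfl, by omega⟩
    · exact ⟨Or.inr ⟨y, hy, rfl⟩, by omega⟩

theorem blockContent_empty (n : ℕ) : blockContent n ∅ = Finsupp.single 0 n := by
  ext j
  rw [blockContent_apply, Finsupp.single_apply]
  simp only [blockIndex, Finset.filter_empty, Finset.card_empty]
  split_ifs with h <;> simp [h]

theorem blockContent_consBlock {n t : ℕ} {B : Finset ℕ} (hB : ∀ x ∈ B, 0 < x) (ht : t ≤ n) :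
    blockContent n (consBlock t B) = consContent t (blockContent (n - t) B) := by
  have hIcc : ∀ m, Finset.Icc 1 m = Finset.Ioc 0 m := fun m => by
    ext x; rw [Finset.mem_Icc, Finset.mem_Ioc]; omega
  rw [blockContent, hIcc, ← Finset.sum_Ioc_consecutive _ (Nat.zero_le t) ht, consContent]
  congr 1
  · rw [Finset.sum_congr rfl fun i hi => by
      rw [blockIndex_consBlock_of_le B (Finset.mem_Ioc.1 hi).2]]
    simp
  · rw [blockContent, Finsupp.embDomain_eq_mapDomain, Finsupp.mapDomain_finsetSum]
    simp only [Finsupp.mapDomain_single]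
    symm
    refine Finset.sum_bij (fun i _ => i + t) ?_ ?_ ?_ ?_
    · intro i hi
      rw [Finset.mem_Icc] at hi
      rw [Finset.mem_Ioc]
      omega
    · intro i _ j _ h
      exact Nat.add_right_cancel h
    · intro i hi
      rw [Finset.mem_Ioc] at hi
      exact ⟨i - t, by rw [Finset.mem_Icc]; omega, by omega⟩
    · intro i hi
      rw [Finset.mem_Icc] at hi
      rw [blockIndex_consBlock_add hB (by omega)]
      rfl

/-- A nonempty `B` corresponds to its minimum `t` and to the rest of `B` shifted down by `t`. -/
theorem sum_powerset_eq_sum_consBlock (S : Finset ℕ) (R : ℕ → Finset ℕ)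
    (hR : ∀ t ∈ S, ∀ x, x ∈ R t ↔ 0 < x ∧ x + t ∈ S) (g : Finset ℕ → ℚ) :
    ∑ B ∈ S.powerset, g B =
      g ∅ + ∑ t ∈ S, ∑ B ∈ (R t).powerset, g (consBlock t B) := by
  rw [← Finset.add_sum_erase _ _ (Finset.empty_mem_powerset S), Finset.sum_sigma']
  congr 1
  symm
  refine Finset.sum_bij (fun x _ => consBlock x.1 x.2) ?_ ?_ ?_ ?_
  · rintro ⟨t, B⟩ h
    rw [Finset.mem_sigma, Finset.mem_powerset] at h
    rw [Finset.mem_erase, Finset.mem_powerset]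
    refine ⟨Finset.ne_empty_of_mem (mem_consBlock.2 (Or.inl rfl)), fun x hx => ?_⟩
    rw [mem_consBlock] at hx
    rcases hx with rfl | ⟨y, hy, rfl⟩
    · exact h.1
    · exact ((hR t h.1 y).1 (h.2 hy)).2
  · rintro ⟨t, B⟩ h ⟨t', B'⟩ h' heq
    rw [Finset.mem_sigma, Finset.mem_powerset] at h h'
    dsimp only at heq h h'
    have hp : ∀ y ∈ B, 0 < y := fun y hy => ((hR t h.1 y).1 (h.2 hy)).1
    have hp' : ∀ y ∈ B', 0 < y := fun y hy => ((hR t' h'.1 y).1 (h'.2 hy)).1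
    have e1 : t ∈ consBlock t' B' := heq ▸ mem_consBlock.2 (Or.inl rfl)
    have e2 : t' ∈ consBlock t B := heq ▸ mem_consBlock.2 (Or.inl rfl)
    rw [mem_consBlock] at e1 e2
    have htt : t = t' := by
      rcases e1 with e1 | ⟨y, _, e1⟩
      · exact e1
      · rcases e2 with e2 | ⟨z, _, e2⟩ <;> omega
    subst htt
    congr 1
    ext y
    have := Finset.ext_iff.1 heq (y + t)
    rw [mem_consBlock, mem_consBlock] at this
    constructor
    · intro hy
      have hy0 := hp y hy
      rcases this.1 (Or.inr ⟨y, hy, rfl⟩) with h1 | ⟨z, hz, h1⟩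
      · omega
      · rwa [← Nat.add_right_cancel h1]
    · intro hy
      have hy0 := hp' y hy
      rcases this.2 (Or.inr ⟨y, hy, rfl⟩) with h1 | ⟨z, hz, h1⟩
      · omega
      · rwa [← Nat.add_right_cancel h1]
  · intro B hB
    rw [Finset.mem_erase, Finset.mem_powerset] at hB
    have hne := Finset.nonempty_iff_ne_empty.2 hB.1
    have hmin := hB.2 (B.min'_mem hne)
    refine ⟨⟨B.min' hne, (R (B.min' hne)).filter fun x => x + B.min' hne ∈ B⟩, ?_, ?_⟩
    · rw [Finset.mem_sigma, Finset.mem_powerset]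
      exact ⟨hmin, Finset.filter_subset _ _⟩
    · ext x
      simp only [mem_consBlock, Finset.mem_filter]
      constructor
      · rintro (rfl | ⟨y, ⟨_, hy⟩, rfl⟩)
        · exact B.min'_mem hne
        · exact hy
      · intro hx
        rcases (B.min'_le x hx).eq_or_lt with h | h
        · exact Or.inl h.symm
        · refine Or.inr ⟨x - B.min' hne, ⟨?_, ?_⟩, by omega⟩
          · rw [hR _ hmin, Nat.sub_add_cancel h.le]
            exact ⟨by omega, hB.2 hx⟩
          · rwa [Nat.sub_add_cancel h.le]
  · intro _ _
    rfl

/-! ### The recursion for even and odd positions. -/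

/-- `{2, 4, 6, …} ∩ {1, …, n - 1}` as a finset. -/
def evenFinset (n : ℕ) : Finset ℕ := (Finset.range n).filter fun i => 1 ≤ i ∧ Even i

/-- `{1, 3, 5, …} ∩ {1, …, n - 1}` as a finset. -/
def oddFinset (n : ℕ) : Finset ℕ := (Finset.range n).filter fun i => 1 ≤ i ∧ Odd i

theorem mem_evenFinset {n i : ℕ} : i ∈ evenFinset n ↔ i < n ∧ 1 ≤ i ∧ Even i := by
  simp [evenFinset]

theorem mem_oddFinset {n i : ℕ} : i ∈ oddFinset n ↔ i < n ∧ 1 ≤ i ∧ Odd i := by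
  simp [oddFinset]

theorem coe_evenFinset (n : ℕ) : (evenFinset n : Set ℕ) = evenPositions n := by
  ext i
  rw [Finset.mem_coe, mem_evenFinset]
  show _ ↔ 1 ≤ i ∧ i < n ∧ Even i
  tauto

theorem coe_oddFinset (n : ℕ) : (oddFinset n : Set ℕ) = oddPositions n := by
  ext i
  rw [Finset.mem_coe, mem_oddFinset]
  show _ ↔ 1 ≤ i ∧ i < n ∧ Odd i
  tauto

/-- The pairing with a ribbon up to sign. -/
noncomputable def signedSum (n : ℕ) (S : Finset ℕ) (f : MvPowerSeries ℕ ℚ) : ℚ :=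
  ∑ B ∈ S.powerset, (-1 : ℚ) ^ B.card * MvPowerSeries.coeff (blockContent n B) f

theorem ribbonPairing_eq_signedSum (n : ℕ) (S : Finset ℕ) (f : MvPowerSeries ℕ ℚ) :
    ribbonPairing n S f = (-1) ^ S.card * signedSum n S f := by
  rw [ribbonPairing_apply, signedSum, Finset.mul_sum]
  refine Finset.sum_congr rfl fun B hB => ?_
  rw [Finset.mem_powerset] at hB
  have h := Finset.card_sdiff_add_card_eq_card hB
  rw [← h, pow_add, ← mul_assoc, mul_assoc ((-1 : ℚ) ^ _), ← mul_pow]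
  norm_num

/-- The empty `B` gives the term `1`; otherwise the first block absorbs a set `J` of parts. By `hR`
the remaining positions are even ones: differences of two even or of two odd numbers are even, so
both kinds of `S` lead to the same remainder. -/
theorem signedSum_prod_powerSum (w : ι → ℕ) (hw : ∀ i, w i ≠ 0) (I : Finset ι) (S : Finset ℕ)
    (hS : ∀ t ∈ S, t < ∑ i ∈ I, w i)
    (hR : ∀ t ∈ S, ∀ x, x ∈ evenFinset (∑ i ∈ I, w i - t) ↔ 0 < x ∧ x + t ∈ S) :
    signedSum (∑ i ∈ I, w i) S (∏ i ∈ I, powerSum (w i)) =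
      1 - ∑ J ∈ I.powerset with ∑ i ∈ J, w i ∈ S,
        signedSum (∑ i ∈ I \ J, w i) (evenFinset (∑ i ∈ I \ J, w i))
          (∏ i ∈ I \ J, powerSum (w i)) := by
  rw [signedSum, sum_powerset_eq_sum_consBlock S _ hR, blockContent_empty, Finset.card_empty,
    pow_zero, one_mul, coeff_single_prod_powerSum w hw, sub_eq_add_neg, Finset.sum_filter]
  congr 1
  have hsum : ∀ J ∈ I.powerset, (if ∑ i ∈ J, w i ∈ S then
      signedSum (∑ i ∈ I \ J, w i) (evenFinset (∑ i ∈ I \ J, w i))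
        (∏ i ∈ I \ J, powerSum (w i)) else 0) =
      ∑ t ∈ S, if ∑ i ∈ J, w i = t then
        signedSum (∑ i ∈ I, w i - t) (evenFinset (∑ i ∈ I, w i - t))
          (∏ i ∈ I \ J, powerSum (w i)) else 0 := by
    intro J hJ
    rw [Finset.mem_powerset] at hJ
    rw [Finset.sum_ite_eq]
    have h := Finset.sum_sdiff (f := w) hJ
    rw [show ∑ i ∈ I, w i - ∑ i ∈ J, w i = ∑ i ∈ I \ J, w i by omega]
  rw [Finset.sum_congr rfl hsum, Finset.sum_comm, ← Finset.sum_neg_distrib]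
  refine Finset.sum_congr rfl fun t ht => ?_
  simp only [signedSum]
  have hB : ∀ B ∈ (evenFinset (∑ i ∈ I, w i - t)).powerset,
      (-1 : ℚ) ^ (consBlock t B).card * MvPowerSeries.coeff
        (blockContent (∑ i ∈ I, w i) (consBlock t B)) (∏ i ∈ I, powerSum (w i)) =
      - ∑ J ∈ I.powerset, if ∑ i ∈ J, w i = t then (-1 : ℚ) ^ B.card * MvPowerSeries.coeff
        (blockContent (∑ i ∈ I, w i - t) B) (∏ i ∈ I \ J, powerSum (w i)) else 0 := by
    intro B hB
    rw [Finset.mem_powerset] at hB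
    have hpos : ∀ x ∈ B, 0 < x := fun x hx => (mem_evenFinset.1 (hB hx)).2.1
    rw [card_consBlock hpos, blockContent_consBlock hpos (hS t ht).le,
      coeff_consContent_prod_powerSum w hw, Finset.mul_sum, ← Finset.sum_neg_distrib]
    refine Finset.sum_congr rfl fun J _ => ?_
    split_ifs <;> ring
  rw [Finset.sum_congr rfl hB, Finset.sum_neg_distrib, Finset.sum_comm]
  congr 1
  refine Finset.sum_congr rfl fun J _ => ?_
  split_ifs
  · rfl
  · exact Finset.sum_const_zero

/-- The signed sum for reverse alternating ribbons at a product of power sums. -/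
noncomputable def evenSum (w : ι → ℕ) (I : Finset ι) : ℚ :=
  signedSum (∑ i ∈ I, w i) (evenFinset (∑ i ∈ I, w i)) (∏ i ∈ I, powerSum (w i))

/-- The signed sum for alternating ribbons at a product of power sums. -/
noncomputable def oddSum (w : ι → ℕ) (I : Finset ι) : ℚ :=
  signedSum (∑ i ∈ I, w i) (oddFinset (∑ i ∈ I, w i)) (∏ i ∈ I, powerSum (w i))

theorem evenSum_eq (w : ι → ℕ) (hw : ∀ i, w i ≠ 0) (I : Finset ι) :
    evenSum w I = 1 - ∑ J ∈ I.powerset with J ≠ I ∧ J ≠ ∅ ∧ Even (∑ i ∈ J, w i),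
      evenSum w (I \ J) := by
  rw [evenSum, signedSum_prod_powerSum w hw]
  · congr 1
    refine Finset.sum_congr (Finset.filter_congr fun J hJ => ?_) fun _ _ => rfl
    rw [mem_evenFinset, sum_weights_lt_iff w hw (Finset.mem_powerset.1 hJ),
      one_le_sum_weights_iff w hw]
  · exact fun t ht => (mem_evenFinset.1 ht).1
  · intro t ht x
    rw [mem_evenFinset] at ht
    rw [mem_evenFinset, mem_evenFinset, Nat.even_add]
    have := ht.2.2
    constructor
    · rintro ⟨h1, h2, h3⟩
      exact ⟨by omega, by omega, by omega, by tauto⟩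
    · rintro ⟨h1, h2, h3, h4⟩
      exact ⟨by omega, by omega, by tauto⟩

theorem oddSum_eq (w : ι → ℕ) (hw : ∀ i, w i ≠ 0) (I : Finset ι) :
    oddSum w I = 1 - ∑ J ∈ I.powerset with J ≠ I ∧ Odd (∑ i ∈ J, w i), evenSum w (I \ J) := by
  rw [oddSum, signedSum_prod_powerSum w hw]
  · congr 1
    refine Finset.sum_congr (Finset.filter_congr fun J hJ => ?_) fun _ _ => rfl
    rw [mem_oddFinset, sum_weights_lt_iff w hw (Finset.mem_powerset.1 hJ)]
    refine and_congr_right fun _ => and_iff_right_of_imp fun h => h.pos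
  · exact fun t ht => (mem_oddFinset.1 ht).1
  · intro t ht x
    rw [mem_oddFinset] at ht
    rw [mem_evenFinset, mem_oddFinset, Nat.odd_add]
    have := ht.2.2
    rw [← Nat.not_even_iff_odd] at this ⊢
    constructor
    · rintro ⟨h1, h2, h3⟩
      exact ⟨by omega, by omega, by omega, by tauto⟩
    · rintro ⟨h1, h2, h3, h4⟩
      exact ⟨by omega, by omega, by tauto⟩

/-! ### Effect of even parts, and dependence on parities only. -/

theorem evenSum_empty (w : ι → ℕ) (hw : ∀ i, w i ≠ 0) : evenSum w ∅ = 1 := by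
  rw [evenSum_eq w hw]
  simp +contextual [Finset.filter_eq_empty_iff]

theorem evenSum_singleton (w : ι → ℕ) (hw : ∀ i, w i ≠ 0) (i : ι) : evenSum w {i} = 1 := by
  rw [evenSum_eq w hw, Finset.sum_eq_zero, sub_zero]
  intro J hJ
  rw [Finset.mem_filter, Finset.mem_powerset, Finset.subset_singleton_iff] at hJ
  tauto

theorem insert_sdiff_insert_of_notMem {i : ι} {I : Finset ι} (hi : i ∉ I) (J : Finset ι) :
    insert i I \ insert i J = I \ J := by
  ext x
  simp only [Finset.mem_sdiff, Finset.mem_insert]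
  constructor
  · rintro ⟨rfl | h1, h2⟩ <;> tauto
  · rintro ⟨h1, h2⟩
    refine ⟨Or.inr h1, ?_⟩
    rintro (rfl | h)
    · exact hi h1
    · exact h2 h

theorem insert_sdiff_of_subset {i : ι} {I J : Finset ι} (hi : i ∉ I) (hJ : J ⊆ I) :
    insert i I \ J = insert i (I \ J) :=
  Finset.insert_sdiff_of_notMem _ fun h => hi (hJ h)

theorem insert_eq_insert_iff {i : ι} {I J : Finset ι} (hi : i ∉ I) (hJ : J ⊆ I) :
    insert i J = insert i I ↔ J = I := by
  constructor
  · intro h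
    rw [← Finset.erase_insert hi, ← h, Finset.erase_insert fun h' => hi (hJ h')]
  · rintro rfl
    rfl

theorem even_sum_insert_iff (w : ι → ℕ) {i : ι} {I J : Finset ι} (hi : i ∉ I) (hJ : J ⊆ I)
    (he : Even (w i)) : Even (∑ j ∈ insert i J, w j) ↔ Even (∑ j ∈ J, w j) := by
  rw [Finset.sum_insert fun h => hi (hJ h), Nat.even_add]
  tauto

theorem even_sum_sdiff_iff (w : ι → ℕ) {I J : Finset ι} (hJ : J ⊆ I) :
    Even (∑ j ∈ I \ J, w j) ↔ (Even (∑ j ∈ I, w j) ↔ Even (∑ j ∈ J, w j)) := by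
  rw [← Finset.sum_sdiff hJ, Nat.even_add]
  tauto

theorem sdiff_ne_empty {I J : Finset ι} (hJ : J ⊆ I) (h : J ≠ I) : I \ J ≠ ∅ := by
  rw [Ne, Finset.sdiff_eq_empty_iff_subset]
  exact fun h' => h (hJ.antisymm h')

/-- In the recursion, sets containing `i` contribute `1` in total, by the recursion for `I` and the
extra set `{i}`. Sets avoiding `i` contribute `evenSum w I` or `0` by induction. The case `I = ∅` is
a real exception: `evenSum` is `1` both at `∅` and at `{i}`. -/
theorem evenSum_insert (w : ι → ℕ) (hw : ∀ i, w i ≠ 0) (I : Finset ι) :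
    I ≠ ∅ → ∀ i ∉ I, Even (w i) →
      evenSum w (insert i I) = if Even (∑ j ∈ I, w j) then -evenSum w I else 0 := by
  induction I using Finset.strongInduction with
  | H I ih =>
    intro hI i hi he
    have hrec : (∑ J ∈ I.powerset, if J ≠ I ∧ J ≠ ∅ ∧ Even (∑ i ∈ J, w i) then
        evenSum w (I \ J) else 0) = 1 - evenSum w I := by
      rw [evenSum_eq w hw I, Finset.sum_filter]; ring
    have hneg : (∑ J ∈ I.powerset, if J ≠ I ∧ J ≠ ∅ ∧ Even (∑ i ∈ J, w i) then
        if Even (∑ j ∈ I, w j) then -evenSum w (I \ J) else 0 else 0) =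
        if Even (∑ j ∈ I, w j) then -(1 - evenSum w I) else 0 := by
      rw [← hrec, ← Finset.sum_neg_distrib]
      by_cases h : Even (∑ j ∈ I, w j)
      · rw [if_pos h]
        refine Finset.sum_congr rfl fun J _ => ?_
        rw [if_pos h]
        split_ifs <;> simp
      · simp [h]
    -- Sets avoiding `i`: `J = I` is now allowed and leaves only `{i}`. For the others the induction
    -- hypothesis applies, and `I \ J` has the parity of `I` because `J` is even.
    have h1 : ∀ J ∈ I.powerset, (if J ≠ insert i I ∧ J ≠ ∅ ∧ Even (∑ i ∈ J, w i) then
        evenSum w (insert i I \ J) else 0) =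
        (if J = I then if Even (∑ j ∈ I, w j) then 1 else 0 else 0) +
        if J ≠ I ∧ J ≠ ∅ ∧ Even (∑ i ∈ J, w i) then
          if Even (∑ j ∈ I, w j) then -evenSum w (I \ J) else 0 else 0 := by
      intro J hJ
      rw [Finset.mem_powerset] at hJ
      have hne : J ≠ insert i I := fun h => hi (hJ (h ▸ Finset.mem_insert_self i I))
      rw [insert_sdiff_of_subset hi hJ]
      by_cases hJI : J = I
      · subst hJI
        simp [hne, hI, evenSum_singleton w hw]
      · by_cases hJ0 : J = ∅
        · subst hJ0
          simp [hJI]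
        · by_cases hev : Even (∑ i ∈ J, w i)
          · rw [ih (I \ J) (Finset.sdiff_ssubset hJ (Finset.nonempty_iff_ne_empty.2 hJ0))
              (sdiff_ne_empty hJ hJI) i (fun h => hi (Finset.sdiff_subset h)) he]
            have hpar : Even (∑ j ∈ I \ J, w j) ↔ Even (∑ j ∈ I, w j) := by
              rw [even_sum_sdiff_iff w hJ]; tauto
            simp only [hpar, ne_eq, hne, hJ0, hJI, hev, not_false_eq_true, true_and, if_true,
              if_false, zero_add]
          · simp [hev, hJI]
    -- Sets containing `i`: the even part does not affect parity, and `J = ∅` is now allowed and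
    -- leaves `I`.
    have h2 : ∀ J ∈ I.powerset, (if insert i J ≠ insert i I ∧ insert i J ≠ ∅ ∧
        Even (∑ j ∈ insert i J, w j) then evenSum w (insert i I \ insert i J) else 0) =
        (if J = ∅ then evenSum w I else 0) +
        if J ≠ I ∧ J ≠ ∅ ∧ Even (∑ i ∈ J, w i) then evenSum w (I \ J) else 0 := by
      intro J hJ
      rw [Finset.mem_powerset] at hJ
      simp only [insert_sdiff_insert_of_notMem hi, even_sum_insert_iff w hi hJ he, ne_eq,
        insert_eq_insert_iff hi hJ]
      by_cases hJ0 : J = ∅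
      · subst hJ0
        simp [hI.symm]
      · simp [hJ0]
    rw [evenSum_eq w hw, Finset.sum_filter, Finset.sum_powerset_insert hi,
      Finset.sum_congr rfl h1, Finset.sum_congr rfl h2, Finset.sum_add_distrib,
      Finset.sum_add_distrib, hrec, hneg, Finset.sum_ite_eq' I.powerset ∅,
      if_pos (Finset.empty_mem_powerset I), Finset.sum_ite_eq' I.powerset I,
      if_pos (Finset.mem_powerset_self I)]
    split_ifs <;> ring

/-- The split is that of `evenSum_insert`, but `J` is odd, so `I \ J` and `I` have opposite
parities. As `∅` has even sum it is never a first block, and `I = ∅` needs no exclusion. -/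
theorem oddSum_insert (w : ι → ℕ) (hw : ∀ i, w i ≠ 0) (I : Finset ι) (i : ι) (hi : i ∉ I)
    (he : Even (w i)) :
    oddSum w (insert i I) = if Even (∑ j ∈ I, w j) then oddSum w I else 0 := by
  have hrec : (∑ J ∈ I.powerset, if J ≠ I ∧ Odd (∑ i ∈ J, w i) then
      evenSum w (I \ J) else 0) = 1 - oddSum w I := by
    rw [oddSum_eq w hw I, Finset.sum_filter]; ring
  have hneg : (∑ J ∈ I.powerset, if J ≠ I ∧ Odd (∑ i ∈ J, w i) then
      if Even (∑ j ∈ I, w j) then 0 else -evenSum w (I \ J) else 0) =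
      if Even (∑ j ∈ I, w j) then 0 else -(1 - oddSum w I) := by
    rw [← hrec, ← Finset.sum_neg_distrib]
    by_cases h : Even (∑ j ∈ I, w j)
    · simp [h]
    · rw [if_neg h]
      refine Finset.sum_congr rfl fun J _ => ?_
      rw [if_neg h]
      split_ifs <;> simp
  have h1 : ∀ J ∈ I.powerset, (if J ≠ insert i I ∧ Odd (∑ i ∈ J, w i) then
      evenSum w (insert i I \ J) else 0) =
      (if J = I then if Even (∑ j ∈ I, w j) then 0 else 1 else 0) +
      if J ≠ I ∧ Odd (∑ i ∈ J, w i) then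
        if Even (∑ j ∈ I, w j) then 0 else -evenSum w (I \ J) else 0 := by
    intro J hJ
    rw [Finset.mem_powerset] at hJ
    have hne : J ≠ insert i I := fun h => hi (hJ (h ▸ Finset.mem_insert_self i I))
    rw [insert_sdiff_of_subset hi hJ]
    by_cases hJI : J = I
    · subst hJI
      simp only [ne_eq, hne, not_false_eq_true, true_and, sdiff_self, Finset.bot_eq_empty,
        insert_empty_eq, evenSum_singleton w hw, if_true, not_true_eq_false, false_and, if_false,
        add_zero]
      by_cases hev : Even (∑ j ∈ J, w j)
      · rw [if_neg (Nat.not_odd_iff_even.2 hev), if_pos hev]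
      · rw [if_pos (Nat.not_even_iff_odd.1 hev), if_neg hev]
    · by_cases hev : Odd (∑ i ∈ J, w i)
      · rw [evenSum_insert w hw (I \ J) (sdiff_ne_empty hJ hJI) i
          (fun h => hi (Finset.sdiff_subset h)) he]
        have hev' := Nat.not_even_iff_odd.2 hev
        have hpar : Even (∑ j ∈ I \ J, w j) ↔ ¬ Even (∑ j ∈ I, w j) := by
          rw [even_sum_sdiff_iff w hJ]; tauto
        simp only [hpar, ne_eq, hne, hJI, hev, not_false_eq_true, true_and, if_true,
          if_false, zero_add, ite_not]
      · simp [hev, hJI]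
  have h2 : ∀ J ∈ I.powerset, (if insert i J ≠ insert i I ∧
      Odd (∑ j ∈ insert i J, w j) then evenSum w (insert i I \ insert i J) else 0) =
      if J ≠ I ∧ Odd (∑ i ∈ J, w i) then evenSum w (I \ J) else 0 := by
    intro J hJ
    rw [Finset.mem_powerset] at hJ
    simp only [insert_sdiff_insert_of_notMem hi, ← Nat.not_even_iff_odd,
      even_sum_insert_iff w hi hJ he, ne_eq, insert_eq_insert_iff hi hJ]
  rw [oddSum_eq w hw, Finset.sum_filter, Finset.sum_powerset_insert hi,
    Finset.sum_congr rfl h1, Finset.sum_congr rfl h2, Finset.sum_add_distrib,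
    hrec, hneg, Finset.sum_ite_eq' I.powerset I, if_pos (Finset.mem_powerset_self I)]
  split_ifs <;> ring

theorem even_sum_congr {κ : Type*} {w w' : κ → ℕ} {J : Finset κ} (h : ∀ i ∈ J, (Even (w i) ↔ Even (w' i))) :
    Even (∑ i ∈ J, w i) ↔ Even (∑ i ∈ J, w' i) := by
  rw [Finset.even_sum_iff_even_card_odd, Finset.even_sum_iff_even_card_odd]
  rw [Finset.filter_congr fun i hi => by
    rw [← Nat.not_even_iff_odd, h i hi, Nat.not_even_iff_odd]]

/-- The recursion mentions the weights only through parities of subset sums. The totals, and with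
them the sets of positions, may differ between `w` and `w'`. -/
theorem evenSum_congr {w w' : ι → ℕ} (hw : ∀ i, w i ≠ 0) (hw' : ∀ i, w' i ≠ 0) (I : Finset ι) :
    (∀ i ∈ I, (Even (w i) ↔ Even (w' i))) → evenSum w I = evenSum w' I := by
  induction I using Finset.strongInduction with
  | H I ih =>
    intro h
    rw [evenSum_eq w hw, evenSum_eq w' hw']
    congr 1
    refine Finset.sum_congr (Finset.filter_congr fun J hJ => ?_) fun J hJ => ?_
    · rw [even_sum_congr fun i hi => h i (Finset.mem_powerset.1 hJ hi)]
    · rw [Finset.mem_filter, Finset.mem_powerset] at hJ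
      exact ih _ (Finset.sdiff_ssubset hJ.1 (Finset.nonempty_iff_ne_empty.2 hJ.2.2.1))
        fun i hi => h i (Finset.sdiff_subset hi)

theorem oddSum_congr {w w' : ι → ℕ} (hw : ∀ i, w i ≠ 0) (hw' : ∀ i, w' i ≠ 0) (I : Finset ι)
    (h : ∀ i ∈ I, (Even (w i) ↔ Even (w' i))) : oddSum w I = oddSum w' I := by
  rw [oddSum_eq w hw, oddSum_eq w' hw']
  congr 1
  refine Finset.sum_congr (Finset.filter_congr fun J hJ => ?_) fun J hJ => ?_
  · rw [← Nat.not_even_iff_odd, even_sum_congr fun i hi => h i (Finset.mem_powerset.1 hJ hi),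
      Nat.not_even_iff_odd]
  · exact evenSum_congr hw hw' _ fun i hi => h i (Finset.sdiff_subset hi)

/-! ### All parts equal to one: Euler numbers. -/

theorem card_oddFinset (n : ℕ) : (oddFinset n).card = n / 2 := by
  have : oddFinset n = (Finset.range (n / 2)).image fun k => 2 * k + 1 := by
    ext i
    rw [mem_oddFinset, Finset.mem_image]
    constructor
    · rintro ⟨h1, _, k, rfl⟩
      exact ⟨k, by rw [Finset.mem_range]; omega, rfl⟩
    · rintro ⟨k, hk, rfl⟩
      rw [Finset.mem_range] at hk
      exact ⟨by omega, by omega, k, rfl⟩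
  rw [this, Finset.card_image_of_injective _ fun a b h => by simpa using h, Finset.card_range]

theorem card_evenFinset (n : ℕ) : (evenFinset n).card = (n - 1) / 2 := by
  have : evenFinset n = (Finset.range ((n - 1) / 2)).image fun k => 2 * (k + 1) := by
    ext i
    rw [mem_evenFinset, Finset.mem_image]
    constructor
    · rintro ⟨h1, h2, k, rfl⟩
      exact ⟨k - 1, by rw [Finset.mem_range]; omega, by omega⟩
    · rintro ⟨k, hk, rfl⟩
      rw [Finset.mem_range] at hk
      exact ⟨by omega, by omega, k + 1, by omega⟩
  rw [this, Finset.card_image_of_injective _ fun a b h => by simpa using h, Finset.card_range]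

/-- Replacing each letter by its complement exchanges ascents and descents. -/
theorem card_permDescentSet_eq_evenPositions (n : ℕ) :
    Nat.card {w : Equiv.Perm (Fin n) // permDescentSet w = evenPositions n} = eulerNumber n := by
  refine Nat.card_congr ((Equiv.mulLeft (Fin.revPerm : Equiv.Perm (Fin n))).subtypeEquiv
    fun w => ?_)
  have key : ∀ i, 1 ≤ i → i < n →
      (i ∈ permDescentSet (Fin.revPerm * w) ↔ i ∉ permDescentSet w) := by
    intro i hi hin
    obtain ⟨j, rfl⟩ : ∃ j, i = j + 1 := ⟨i - 1, by omega⟩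
    have hmem : ∀ v : Equiv.Perm (Fin n), j + 1 ∈ permDescentSet v ↔
        v ⟨j + 1, hin⟩ < v ⟨j, Nat.lt_of_succ_lt hin⟩ := by
      intro v
      constructor
      · rintro ⟨k, hk, h, hlt⟩
        obtain rfl : j = k := by omega
        exact hlt
      · exact fun h => ⟨j, hin, rfl, h⟩
    rw [hmem, hmem, Equiv.Perm.mul_apply, Equiv.Perm.mul_apply, Fin.revPerm_apply,
      Fin.revPerm_apply, Fin.rev_lt_rev, not_lt]
    have hne : w ⟨j, Nat.lt_of_succ_lt hin⟩ ≠ w ⟨j + 1, hin⟩ := fun h => by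
      simpa using w.injective h
    exact ⟨le_of_lt, fun h => lt_of_le_of_ne h hne⟩
  have hsub : ∀ v : Equiv.Perm (Fin n), ∀ i ∈ permDescentSet v, 1 ≤ i ∧ i < n := by
    rintro v i ⟨j, hj, rfl, _⟩
    exact ⟨by omega, hj⟩
  rw [Equiv.coe_mulLeft, Set.ext_iff, Set.ext_iff]
  refine forall_congr' fun i => ?_
  show (i ∈ permDescentSet w ↔ 1 ≤ i ∧ i < n ∧ Even i) ↔
    (i ∈ permDescentSet (Fin.revPerm * w) ↔ 1 ≤ i ∧ i < n ∧ Odd i)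
  by_cases h : 1 ≤ i ∧ i < n
  · rw [key i h.1 h.2, ← Nat.not_even_iff_odd]
    simp only [h.1, h.2, true_and]
    tauto
  · have h1 := mt (hsub w i) h
    have h2 := mt (hsub (Fin.revPerm * w) i) h
    simp only [h1, h2, false_iff]
    tauto

theorem oddSum_one {κ : Type*} (I : Finset κ) :
    (-1 : ℚ) ^ (I.card / 2) * oddSum (fun _ => 1) I = eulerNumber I.card := by
  have h := ribbonPairing_powerSum_one_pow I.card (oddFinset I.card)
  rw [coe_oddFinset, ribbonPairing_eq_signedSum, card_oddFinset] at h
  rw [eulerNumber, h, oddSum]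
  simp

theorem evenSum_one {κ : Type*} (I : Finset κ) :
    (-1 : ℚ) ^ ((I.card - 1) / 2) * evenSum (fun _ => 1) I = eulerNumber I.card := by
  have h := ribbonPairing_powerSum_one_pow I.card (evenFinset I.card)
  rw [coe_evenFinset, ribbonPairing_eq_signedSum, card_evenFinset,
    card_permDescentSet_eq_evenPositions] at h
  rw [h, evenSum]
  simp

theorem eulerNumber_zero : eulerNumber 0 = 1 := by
  have h := oddSum_one (∅ : Finset ℕ)
  rw [oddSum_eq _ (fun _ => one_ne_zero)] at h
  have h2 : ((eulerNumber 0 : ℕ) : ℚ) = 1 := by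
    rw [← Finset.card_empty (α := ℕ), ← h]
    simp +contextual [Finset.filter_eq_empty_iff]
  exact_mod_cast h2

/-! ### The ribbon functional on arbitrary products of power sums. -/

theorem oddSum_union (w : ι → ℕ) (hw : ∀ i, w i ≠ 0) (O F : Finset ι) (hF : ∀ i ∈ F, Even (w i)) :
    Disjoint O F → oddSum w (O ∪ F) =
      if Even (∑ i ∈ O, w i) ∨ F = ∅ then oddSum w O else 0 := by
  induction F using Finset.induction_on with
  | empty => simp
  | insert i F hi ih =>
    intro hd
    rw [Finset.disjoint_insert_right] at hd
    have hF' : ∀ j ∈ F, Even (w j) := fun j hj => hF j (Finset.mem_insert_of_mem hj)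
    rw [Finset.union_insert, oddSum_insert w hw _ i (by simp [hd.1, hi])
      (hF i (Finset.mem_insert_self i F)), ih hF' hd.2, Finset.sum_union hd.2]
    have := Finset.even_sum w hF'
    simp only [Nat.even_add, this, iff_true, Finset.insert_ne_empty, or_false]
    split_ifs <;> tauto

theorem evenSum_union (w : ι → ℕ) (hw : ∀ i, w i ≠ 0) (O F : Finset ι) (hO : O ≠ ∅)
    (hF : ∀ i ∈ F, Even (w i)) :
    Disjoint O F → evenSum w (O ∪ F) =
      if Even (∑ i ∈ O, w i) ∨ F = ∅ then (-1) ^ F.card * evenSum w O else 0 := by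
  induction F using Finset.induction_on with
  | empty => simp
  | insert i F hi ih =>
    intro hd
    rw [Finset.disjoint_insert_right] at hd
    have hF' : ∀ j ∈ F, Even (w j) := fun j hj => hF j (Finset.mem_insert_of_mem hj)
    have hne : O ∪ F ≠ ∅ := fun h => hO (Finset.union_eq_empty.1 h).1
    rw [Finset.union_insert, evenSum_insert w hw _ hne i (by simp [hd.1, hi])
      (hF i (Finset.mem_insert_self i F)), ih hF' hd.2, Finset.sum_union hd.2,
      Finset.card_insert_of_notMem hi, pow_succ]
    have := Finset.even_sum w hF'
    simp only [Nat.even_add, this, iff_true, Finset.insert_ne_empty, or_false]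
    split_ifs
    · ring
    · tauto
    · rfl

/-- The first even part costs no sign, whence the exponent `F.card - 1`. -/
theorem evenSum_of_forall_even (w : ι → ℕ) (hw : ∀ i, w i ≠ 0) (F : Finset ι) :
    (∀ i ∈ F, Even (w i)) → F ≠ ∅ → evenSum w F = (-1) ^ (F.card - 1) := by
  induction F using Finset.induction_on with
  | empty => simp
  | insert i F hi ih =>
    intro hF _
    have hF' : ∀ j ∈ F, Even (w j) := fun j hj => hF j (Finset.mem_insert_of_mem hj)
    by_cases hF0 : F = ∅
    · subst hF0
      simp [evenSum_singleton w hw]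
    · rw [evenSum_insert w hw F hF0 i hi (hF i (Finset.mem_insert_self i F)),
        if_pos (Finset.even_sum w hF'), ih hF' hF0, Finset.card_insert_of_notMem hi]
      obtain ⟨m, hm⟩ : ∃ m, F.card = m + 1 :=
        ⟨F.card - 1, by have := Finset.card_pos.2 (Finset.nonempty_iff_ne_empty.2 hF0); omega⟩
      rw [hm, Nat.add_sub_cancel, Nat.add_sub_cancel, pow_succ]
      ring

theorem sum_eq_two_mul_add_card_odd {κ : Type*} (w : κ → ℕ) (I : Finset κ) :
    ∑ i ∈ I, w i = 2 * ∑ i ∈ I, w i / 2 + (I.filter fun i => Odd (w i)).card := by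
  rw [Finset.mul_sum, Finset.card_filter, ← Finset.sum_add_distrib]
  refine Finset.sum_congr rfl fun i _ => ?_
  split_ifs with h
  · rw [Nat.odd_iff] at h
    omega
  · rw [Nat.not_odd_iff] at h
    omega

/-- Even parts are removed by `oddSum_union` and odd parts replaced by `1`. Replacing them changes
the number of descent positions, and the sign `(-1) ^ (∑ i ∈ I, w i / 2)` records the difference. -/
theorem ribbonPairing_oddFinset (w : ι → ℕ) (hw : ∀ i, w i ≠ 0) (I : Finset ι) :
    ribbonPairing (∑ i ∈ I, w i) (oddFinset (∑ i ∈ I, w i)) (∏ i ∈ I, powerSum (w i)) =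
      (-1) ^ (∑ i ∈ I, w i / 2) *
        (if Even (∑ i ∈ I, w i) then (1 : ℚ) else 0) ^ (I.filter fun i => ¬ Odd (w i)).card *
        eulerNumber (I.filter fun i => Odd (w i)).card := by
  set O := I.filter fun i => Odd (w i) with hO
  set F := I.filter fun i => ¬ Odd (w i) with hF
  have hn := sum_eq_two_mul_add_card_odd w I
  have hnO := sum_eq_two_mul_add_card_odd w O
  rw [← hO] at hn
  rw [hO, Finset.filter_filter, Finset.filter_congr fun i _ => and_self_iff, ← hO] at hnO
  have hI : I = O ∪ F := (Finset.filter_union_filter_not_eq _ I).symm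
  have hdisj : Disjoint O F := Finset.disjoint_filter_filter_not _ _ _
  have h1 := oddSum_union w hw O F
    (fun i hi => Nat.not_odd_iff_even.1 (Finset.mem_filter.1 hi).2) hdisj
  have h2 : oddSum w O = oddSum (fun _ => 1) O := oddSum_congr hw (fun _ => one_ne_zero) O
    fun i hi => by
      have := Nat.not_even_iff_odd.2 (Finset.mem_filter.1 hi).2
      simp [this]
  have h3 := oddSum_one O
  have hpar : Even (∑ i ∈ O, w i) ↔ Even (∑ i ∈ I, w i) := by
    rw [Nat.even_iff, Nat.even_iff]
    omega
  rw [ribbonPairing_eq_signedSum, card_oddFinset,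
    show (∑ i ∈ I, w i) / 2 = ∑ i ∈ I, w i / 2 + O.card / 2 by omega, ← h3, pow_add]
  change _ * oddSum w I = _
  rw [show oddSum w I = oddSum w (O ∪ F) by rw [← hI], h1, h2]
  simp only [hpar]
  by_cases he : Even (∑ i ∈ I, w i)
  · simp only [he, true_or, if_true, one_pow]
    ring
  · by_cases hF0 : F = ∅
    · simp only [hF0, or_true, if_true, Finset.card_empty, pow_zero]
      ring
    · have : F.card ≠ 0 := by rwa [Ne, Finset.card_eq_zero]
      simp [he, hF0]

theorem ribbonPairing_evenFinset (w : ι → ℕ) (hw : ∀ i, w i ≠ 0) (I : Finset ι) :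
    ribbonPairing (∑ i ∈ I, w i) (evenFinset (∑ i ∈ I, w i)) (∏ i ∈ I, powerSum (w i)) =
      (-1) ^ (∑ i ∈ I, w i / 2) *
        (if Even (∑ i ∈ I, w i) then (-1 : ℚ) else 0) ^ (I.filter fun i => ¬ Odd (w i)).card *
        eulerNumber (I.filter fun i => Odd (w i)).card := by
  set O := I.filter fun i => Odd (w i) with hO
  set F := I.filter fun i => ¬ Odd (w i) with hF
  have hn := sum_eq_two_mul_add_card_odd w I
  have hnO := sum_eq_two_mul_add_card_odd w O
  rw [← hO] at hn
  rw [hO, Finset.filter_filter, Finset.filter_congr fun i _ => and_self_iff, ← hO] at hnO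
  have hI : I = O ∪ F := (Finset.filter_union_filter_not_eq _ I).symm
  have hdisj : Disjoint O F := Finset.disjoint_filter_filter_not _ _ _
  have hFe : ∀ i ∈ F, Even (w i) := fun i hi => Nat.not_odd_iff_even.1 (Finset.mem_filter.1 hi).2
  rw [ribbonPairing_eq_signedSum, card_evenFinset]
  change _ * evenSum w I = _
  by_cases hO0 : O = ∅
  · have hIF : I = F := by rw [hI, hO0, Finset.empty_union]
    rw [hO0, Finset.card_empty] at hn
    rw [hO0, Finset.card_empty, eulerNumber_zero]
    have he : Even (∑ i ∈ I, w i) := by rw [Nat.even_iff]; omega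
    by_cases hF0 : F = ∅
    · rw [hIF, hF0]
      simp [evenSum_empty w hw]
    · have hpos := (one_le_sum_weights_iff w hw I).2 (hIF ▸ hF0)
      have hcard : F.card ≠ 0 := by rwa [Ne, Finset.card_eq_zero]
      rw [if_pos he, show evenSum w I = evenSum w F by rw [← hIF],
        evenSum_of_forall_even w hw F hFe hF0, Nat.cast_one, mul_one]
      obtain ⟨a, ha⟩ : ∃ a, ∑ i ∈ I, w i / 2 = a + 1 := ⟨∑ i ∈ I, w i / 2 - 1, by omega⟩
      obtain ⟨b, hb⟩ : ∃ b, F.card = b + 1 := ⟨F.card - 1, by omega⟩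
      -- With even parts only, there is one position fewer than half the total and one sign fewer
      -- than the number of parts; the two defects cancel.
      rw [show (∑ i ∈ I, w i - 1) / 2 = a by omega, ha, hb, Nat.add_sub_cancel, pow_succ, pow_succ]
      ring
  · have hOcard : O.card ≠ 0 := by rwa [Ne, Finset.card_eq_zero]
    have h1 := evenSum_union w hw O F hO0 hFe hdisj
    have h2 : evenSum w O = evenSum (fun _ => 1) O := evenSum_congr hw (fun _ => one_ne_zero) O
      fun i hi => by
        have := Nat.not_even_iff_odd.2 (Finset.mem_filter.1 hi).2
        simp [this]
    have h3 := evenSum_one O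
    have hpar : Even (∑ i ∈ O, w i) ↔ Even (∑ i ∈ I, w i) := by
      rw [Nat.even_iff, Nat.even_iff]
      omega
    rw [show (∑ i ∈ I, w i - 1) / 2 = ∑ i ∈ I, w i / 2 + (O.card - 1) / 2 by omega, ← h3, pow_add,
      show evenSum w I = evenSum w (O ∪ F) by rw [← hI], h1, h2]
    simp only [hpar]
    by_cases he : Even (∑ i ∈ I, w i)
    · simp only [he, true_or, if_true]
      ring
    · by_cases hF0 : F = ∅
      · simp only [hF0, or_true, if_true, Finset.card_empty, pow_zero]
        ring
      · have : F.card ≠ 0 := by rwa [Ne, Finset.card_eq_zero]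
        simp [he, hF0]

/-! ### Comparison with the umbral substitution. -/

/-- Umbral evaluation as a linear map. -/
noncomputable def umbralLinear : Polynomial ℚ →ₗ[ℚ] ℚ :=
  Polynomial.lsum fun k => (LinearMap.id : ℚ →ₗ[ℚ] ℚ).smulRight (eulerNumber k : ℚ)

theorem umbralLinear_apply (q : Polynomial ℚ) : umbralLinear q = umbralEval q := rfl

theorem umbralLinear_C_mul_X_pow (c : ℚ) (k : ℕ) :
    umbralLinear (Polynomial.C c * Polynomial.X ^ k) = c * eulerNumber k := by
  rw [umbralLinear_apply, umbralEval, Polynomial.C_mul_X_pow_eq_monomial,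
    Polynomial.sum_monomial_index c (fun k a => a * (eulerNumber k : ℚ)) (zero_mul _)]

/-- The period-four pattern is the sign `(-1) ^ (m / 2)` times a value depending only on the parity
of `m`. The shift to `m - 1` reflects that variable `k` stands for `p_{k+1}`. -/
theorem periodic_pred (β : ℚ) {m : ℕ} (hm : m ≠ 0) :
    periodic E (Polynomial.C β) (-E) (-Polynomial.C β) (m - 1) =
      Polynomial.C ((-1) ^ (m / 2)) * if Odd m then Polynomial.X else Polynomial.C (-β) := by
  have key : m % 4 = 0 ∨ m % 4 = 1 ∨ m % 4 = 2 ∨ m % 4 = 3 := by omega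
  rcases key with h | h | h | h
  · have h1 : (m - 1) % 4 = 3 := by omega
    have h2 : ¬ Odd m := by rw [Nat.odd_iff]; omega
    have h3 : Even (m / 2) := by rw [Nat.even_iff]; omega
    simp [periodic, h1, h2, h3.neg_one_pow]
  · have h1 : (m - 1) % 4 = 0 := by omega
    have h2 : Odd m := by rw [Nat.odd_iff]; omega
    have h3 : Even (m / 2) := by rw [Nat.even_iff]; omega
    simp [periodic, h1, h2, h3.neg_one_pow]
  · have h1 : (m - 1) % 4 = 1 := by omega
    have h2 : ¬ Odd m := by rw [Nat.odd_iff]; omega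
    have h3 : Odd (m / 2) := by rw [Nat.odd_iff]; omega
    simp [periodic, h1, h2, h3.neg_one_pow]
  · have h1 : (m - 1) % 4 = 2 := by omega
    have h2 : Odd m := by rw [Nat.odd_iff]; omega
    have h3 : Odd (m / 2) := by rw [Nat.odd_iff]; omega
    simp [periodic, h1, h2, h3.neg_one_pow]

theorem umbralLinear_prod_periodic {κ : Type*} (w : κ → ℕ) (hw : ∀ i, w i ≠ 0) (I : Finset κ)
    (β : ℚ) : umbralLinear
      (∏ i ∈ I, periodic E (Polynomial.C β) (-E) (-Polynomial.C β) (w i - 1)) =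
      (-1) ^ (∑ i ∈ I, w i / 2) * (-β) ^ (I.filter fun i => ¬ Odd (w i)).card *
        eulerNumber (I.filter fun i => Odd (w i)).card := by
  rw [Finset.prod_congr rfl fun i _ => periodic_pred β (hw i), Finset.prod_mul_distrib,
    Finset.prod_ite, Finset.prod_const, Finset.prod_const, ← map_prod, Finset.prod_pow_eq_pow_sum,
    ← umbralLinear_C_mul_X_pow, map_mul Polynomial.C, map_pow Polynomial.C (-β)]
  congr 1
  ring

/-- Both sides are linear in `P`, so agreement on each monomial of weight `n` suffices. -/
theorem ribbonPairing_powerSumEval (P : MvPolynomial ℕ ℚ) (n : ℕ) (S : Finset ℕ) (β : ℚ)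
    (hP : P.IsWeightedHomogeneous psWeight n)
    (h : ∀ (w : (Σ _ : ℕ, ℕ) → ℕ), (∀ i, w i ≠ 0) → ∀ I : Finset (Σ _ : ℕ, ℕ), ∑ i ∈ I, w i = n →
      ribbonPairing n S (∏ i ∈ I, powerSum (w i)) = (-1) ^ (∑ i ∈ I, w i / 2) *
        (-β) ^ (I.filter fun i => ¬ Odd (w i)).card *
        eulerNumber (I.filter fun i => Odd (w i)).card) :
    ribbonPairing n S (powerSumEval P) =
      umbralSubst P E (Polynomial.C β) (-E) (-Polynomial.C β) := by
  rw [umbralSubst, ← umbralLinear_apply, P.as_sum, map_sum, map_sum, map_sum, map_sum]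
  refine Finset.sum_congr rfl fun m hm => ?_
  -- The power `p_{k+1} ^ m k` is spread over `m k` distinct labels, so that a multiset of parts
  -- becomes a finset with weights.
  let I : Finset (Σ _ : ℕ, ℕ) := m.support.sigma fun k => Finset.range (m k)
  let w : (Σ _ : ℕ, ℕ) → ℕ := fun x => x.1 + 1
  have hw : ∀ i, w i ≠ 0 := fun i => Nat.succ_ne_zero _
  have hI : ∑ i ∈ I, w i = n := by
    rw [← hP (MvPolynomial.mem_support_iff.1 hm), Finsupp.weight_apply, Finsupp.sum,
      Finset.sum_sigma]
    simp [w, psWeight]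
  have e1 : ∏ k ∈ m.support, powerSum (k + 1) ^ m k = ∏ i ∈ I, powerSum (w i) := by
    rw [Finset.prod_sigma]
    simp [w]
  have e2 : ∏ k ∈ m.support, periodic E (Polynomial.C β) (-E) (-Polynomial.C β) k ^ m k =
      ∏ i ∈ I, periodic E (Polynomial.C β) (-E) (-Polynomial.C β) (w i - 1) := by
    rw [Finset.prod_sigma]
    simp [w]
  rw [powerSumEval_monomial, map_smul, e1, h w hw I hI, MvPolynomial.aeval_monomial,
    Finsupp.prod, e2, ← Algebra.smul_def, map_smul, umbralLinear_prod_periodic w hw]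

/-- The value `β` is substituted for `p₂`. By `hβ` it is `-1` in even size and `0` in odd size, so
this one statement serves both parities. -/
theorem alt_eq_umbralSubst (μ : YoungDiagram) (P : MvPolynomial ℕ ℚ)
    (hP : P.IsWeightedHomogeneous psWeight μ.card) (hs : powerSumEval P = schur μ) (β : ℚ)
    (hβ : -β = if Even μ.card then 1 else 0) :
    (alt μ : ℚ) = umbralSubst P E (Polynomial.C β) (-E) (-Polynomial.C β) := by
  rw [alt, ← coe_oddFinset, ribbonPairing_schur, ← hs]
  refine ribbonPairing_powerSumEval P _ _ β hP fun w hw I hI => ?_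
  rw [hβ, ← hI]
  exact ribbonPairing_oddFinset w hw I

theorem ralt_eq_umbralSubst (μ : YoungDiagram) (P : MvPolynomial ℕ ℚ)
    (hP : P.IsWeightedHomogeneous psWeight μ.card) (hs : powerSumEval P = schur μ) (β : ℚ)
    (hβ : -β = if Even μ.card then -1 else 0) :
    (ralt μ : ℚ) = umbralSubst P E (Polynomial.C β) (-E) (-Polynomial.C β) := by
  rw [ralt, ← coe_evenFinset, ribbonPairing_schur, ← hs]
  refine ribbonPairing_powerSumEval P _ _ β hP fun w hw I hI => ?_
  rw [hβ, ← hI]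
  exact ribbonPairing_evenFinset w hw I

end AltTableaux

theorem mainTheorem3 (n : ℕ) (μ : YoungDiagram) (hμ : μ.card = n) :
    (∃! P : MvPolynomial ℕ ℚ, AltTableaux.IsPowerSumExpansion P (AltTableaux.schur μ)) ∧
    ∀ P : MvPolynomial ℕ ℚ, AltTableaux.IsPowerSumExpansion P (AltTableaux.schur μ) →
      (Odd n →
        (AltTableaux.alt μ : ℚ) =
            AltTableaux.umbralSubst P AltTableaux.E 0 (-AltTableaux.E) 0 ∧
        (AltTableaux.ralt μ : ℚ) =
            AltTableaux.umbralSubst P AltTableaux.E 0 (-AltTableaux.E) 0) ∧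
      (Even n →
        (AltTableaux.alt μ : ℚ) =
            AltTableaux.umbralSubst P AltTableaux.E (-1) (-AltTableaux.E) 1 ∧
        (AltTableaux.ralt μ : ℚ) =
            AltTableaux.umbralSubst P AltTableaux.E 1 (-AltTableaux.E) (-1)) := by
  subst hμ
  obtain ⟨Q, hQ, hQs⟩ := AltTableaux.exists_powerSumEval_eq μ.card (AltTableaux.schur μ)
    (AltTableaux.homogeneousSeries_schur μ) (AltTableaux.swapInvariant_schur μ)
  have huniq : ∀ P, AltTableaux.IsPowerSumExpansion P (AltTableaux.schur μ) → P = Q :=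
    fun P hP => AltTableaux.powerSumEval_injective (Eq.trans hP hQs.symm)
  refine ⟨⟨Q, hQs, huniq⟩, fun P hP => ?_⟩
  obtain rfl := huniq P hP
  constructor
  · intro hn
    rw [← Nat.not_even_iff_odd] at hn
    constructor
    · simpa using AltTableaux.alt_eq_umbralSubst μ P hQ hQs 0 (by simp [hn])
    · simpa using AltTableaux.ralt_eq_umbralSubst μ P hQ hQs 0 (by simp [hn])
  · intro hn
    constructor
    · simpa using AltTableaux.alt_eq_umbralSubst μ P hQ hQs (-1) (by simp [hn])
    · simpa using AltTableaux.ralt_eq_umbralSubst μ P hQ hQs 1 (by simp [hn])
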